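/- Setting. For $1\le r\le n$ let $A\in\mathbb{R}^{r\times n}$ have full row rank, let $f:\mathbb{R}^r\to\mathbb{R}$ be convex, and let $\mathcal X\subseteq\mathbb{R}^n$ be such that the problem $$\max\{f(Ax): x\in\mathcal X\}\qquad(\mathrm P)$$ attains its optimum. For $x\in\mathbb{R}^n$ write $\operatorname{supp}(x)=\{i: x_i\ne 0\}$, and for a permutation $\pi$ of $[n]$ let $\mathcal Z(\pi)=\{x: x_{\pi(1)}\ge\dots\ge x_{\pi(n)}\}$. The set $\mathcal X$ is *standard comonotone* if for every $\pi$ and every $v\in\mathcal Z(\pi)$ for which $\max_{x\in\mathcal X}v^\top x$ is attained, it has an optimal solution in $\mathcal Z(\pi)$. For $c\in\mathbb{R}^r$ and $\underline\lambda\le\overline\lambda$ let $\mathcal Q(c,\overline\lambda,\underline\lambda)$ be the set of all $x\in\mathbb{R}^n$ such that, for all $i$, $x_i>0$ if $(A^\top c)_i>\overline\lambda$; $x_i=0$ if $\underline\lambda<(A^\top c)_i<\overline\lambda$; $x_i<0$ if $(A^\top c)_i<\underline\lambda$; and, when $\underline\lambda<\overline\lambda$, $x_i\ge0$ if $(A^\top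 c)_i=\overline\lambda$ and $x_i\le 0$ if $(A^\top c)_i=\underline\lambda$; and such that $x_i\ge x_j$ whenever $i<j$ and $(A^\top c)_i=(A^\top c)_j\in\{\overline\lambda,\underline\lambda\}$. Let $\mathcal Q(c,\overline\lambda,\underline\lambda)=\emptyset$ if $\underline\lambda>\overline\lambda$. Consider the arrangement in the space $\mathbb{R}^r\times\mathbb{R}\times\mathbb{R}$ of triples $(c,\underline\lambda,\overline\lambda)$ of the $2n+1$ hyperplanes $(A^\top c)_i=\overline\lambda$ and $(A^\top c)_i=\underline\lambda$ $(i\in[n])$ and $\overline\lambda=\underline\lambda$. Let $\mathcal S(A)$ be the collection of the sets $\operatorname{supp}(x)$ with $x\in\mathcal Q(c,\overline\lambda,\underline\lambda)$ and $(c,\underline\lambda,\overline\lambda)$ in some cell of this arrangement. Theorem. Fix $r\ge1$. (i) There is a constant $C$, depending only on $r$, such that for all $n$ and $A$ as above, $|\mathcal S(A)|\le C\,n^{r+1}$, and for all $f$ and all standard comonotone $\mathcal X$ as above, some $S\in\mathcal S(A)$ is the support of an optimal solution of $(\mathrm P)$. (ii) Suppose that there is an oracle which, for any $S\subseteq[n]$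 (passed as its indicator vector), returns in time $T_1$ an optimal solution of $\max\{f(Ax): x\in\mathcal X,\ \operatorname{supp}(x)=S\}$ together with its value, or certifies that no optimal solution exists; here $T_1\ge n$, since the oracle has to read its $n$-bit input. Then $(\mathrm P)$ with standard comonotone $\mathcal X$ is solvable in time $O(n^{r+1}\cdot T_1)$: there are a program for the real random access machine (unit-cost exact arithmetic and comparisons of reals, addition and truncated subtraction of integers, indirect addressing, and calls of the oracle at cost $T_1$ each) and a constant $C$, both depending only on $r$, such that for all $n$, $A$, $f$, $\mathcal X$, $T_1$ and all such oracles, the program with input $(n,A)$ halts after time at most $C\,n^{r+1}\,T_1$ and outputs an optimal solution of $(\mathrm P)$. -/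

import Mathlib

open Matrix

namespace Comonotone

/-! ### Optimal solutions and comonotone sets -/

/-- `x` is an optimal solution of `max {g x : x ∈ X}`. -/
def IsMaximizer {n : ℕ} (X : Set (Fin n → ℝ)) (g : (Fin n → ℝ) → ℝ) (x : Fin n → ℝ) : Prop :=
  x ∈ X ∧ ∀ y ∈ X, g y ≤ g x

/-- The cone `Z(π)` of the vectors sorted by `π`: `x (π 1) ≥ ⋯ ≥ x (π n)`. -/
def sortedCone {n : ℕ} (π : Equiv.Perm (Fin n)) : Set (Fin n → ℝ) :=
  {x | ∀ i j : Fin n, i ≤ j → x (π j) ≤ x (π i)}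

/-- `X` is comonotone with permutation mapping `Ψ`. -/
def IsComonotoneUnder {n : ℕ} (Ψ : Equiv.Perm (Fin n) → Equiv.Perm (Fin n))
    (X : Set (Fin n → ℝ)) : Prop :=
  ∀ π : Equiv.Perm (Fin n), ∀ v ∈ sortedCone π,
    (∃ x, IsMaximizer X (fun y => v ⬝ᵥ y) x) →
      ∃ x, IsMaximizer X (fun y => v ⬝ᵥ y) x ∧ x ∈ sortedCone (Ψ π)

/-- `X` is standard comonotone: the permutation mapping can be chosen to be the identity. -/
def IsStandardComonotone {n : ℕ} (X : Set (Fin n → ℝ)) : Prop :=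
  IsComonotoneUnder (fun π => π) X

/-! ### The lifted hyperplane arrangement and its candidate supports -/

/-- The cell with sign vector `s` of the arrangement of the hyperplanes `{p | ℓ i p = 0}`:
for each `i`, the hyperplane itself or one of its two open half-spaces, as `s i` prescribes. -/
def cell {ι V : Type*} [AddCommGroup V] [Module ℝ V] (l : ι → V →ₗ[ℝ] ℝ) (s : ι → SignType) :
    Set V :=
  {p | ∀ i, SignType.sign (l i p) = s i}

/-- The arrangement: the collection of all (nonempty) cells. -/
def arrangement {ι V : Type*} [AddCommGroup V] [Module ℝ V] (l : ι → V →ₗ[ℝ] ℝ) : Set (Set V) :=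
  {R | R.Nonempty ∧ ∃ s : ι → SignType, R = cell l s}

/-- The lifted parameter space of the triples `(c, lower threshold, upper threshold)`. -/
abbrev LiftedSpace (r : ℕ) : Type := (Fin r → ℝ) × ℝ × ℝ

/-- The linear forms whose kernels are the `2 n + 1` hyperplanes of the lifted space:
`(Aᵀ c) i = upper`, `(Aᵀ c) i = lower` for `i ∈ [n]`, and `upper = lower`. -/
def liftedForm {r n : ℕ} (A : Matrix (Fin r) (Fin n) ℝ) :
    Fin n ⊕ Fin n ⊕ Unit → LiftedSpace r →ₗ[ℝ] ℝ
  | Sum.inl i =>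
      LinearMap.proj i ∘ₗ Matrix.mulVecLin Aᵀ ∘ₗ LinearMap.fst ℝ (Fin r → ℝ) (ℝ × ℝ)
        - LinearMap.snd ℝ ℝ ℝ ∘ₗ LinearMap.snd ℝ (Fin r → ℝ) (ℝ × ℝ)
  | Sum.inr (Sum.inl i) =>
      LinearMap.proj i ∘ₗ Matrix.mulVecLin Aᵀ ∘ₗ LinearMap.fst ℝ (Fin r → ℝ) (ℝ × ℝ)
        - LinearMap.fst ℝ ℝ ℝ ∘ₗ LinearMap.snd ℝ (Fin r → ℝ) (ℝ × ℝ)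
  | Sum.inr (Sum.inr _) =>
      LinearMap.snd ℝ ℝ ℝ ∘ₗ LinearMap.snd ℝ (Fin r → ℝ) (ℝ × ℝ)
        - LinearMap.fst ℝ ℝ ℝ ∘ₗ LinearMap.snd ℝ (Fin r → ℝ) (ℝ × ℝ)

/-- The set `Q(c, hi, lo)` of the vectors satisfying the sign and the ordering constraints
at the parameters `lo ≤ hi`; it is empty when `hi < lo`. -/
def thresholdSet {r n : ℕ} (A : Matrix (Fin r) (Fin n) ℝ) (c : Fin r → ℝ) (hi lo : ℝ) :
    Set (Fin n → ℝ) :=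
  {x | lo ≤ hi ∧
    (∀ i,
      (hi < (Aᵀ *ᵥ c) i → 0 < x i) ∧
      (lo < (Aᵀ *ᵥ c) i ∧ (Aᵀ *ᵥ c) i < hi → x i = 0) ∧
      ((Aᵀ *ᵥ c) i < lo → x i < 0) ∧
      ((Aᵀ *ᵥ c) i = hi ∧ lo < hi → 0 ≤ x i) ∧
      ((Aᵀ *ᵥ c) i = lo ∧ lo < hi → x i ≤ 0)) ∧
    ∀ i j, i < j → (Aᵀ *ᵥ c) i = (Aᵀ *ᵥ c) j →
      ((Aᵀ *ᵥ c) i = hi ∨ (Aᵀ *ᵥ c) i = lo) → x j ≤ x i}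

/-- The supports contributed by a cell `R` of the lifted arrangement: the supports of the vectors
in `Q(c, hi, lo)` with `(c, lo, hi) ∈ R` (this set is the same for all points of `R`). -/
def cellSupports {r n : ℕ} (A : Matrix (Fin r) (Fin n) ℝ) (R : Set (LiftedSpace r)) :
    Set (Set (Fin n)) :=
  {S | ∃ p ∈ R, ∃ x ∈ thresholdSet A p.1 p.2.2 p.2.1, Function.support x = S}

/-- The candidate supports: those contributed by the cells of the lifted arrangement. They depend
on the matrix `A` only. -/
def candidateSupports {r n : ℕ} (A : Matrix (Fin r) (Fin n) ℝ) : Set (Set (Fin n)) :=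
  ⋃ R ∈ arrangement (liftedForm A), cellSupports A R

/-! ### A real random access machine with a fixed-support oracle

Programs are finite pieces of code over arrays of natural numbers (used for indices and flags, with
addition and truncated subtraction) and arrays of real numbers (with exact field operations).
Array entries are accessed by computed indices. Each elementary operation, memory access, test and
assignment costs one unit of time. -/

/-- Integer expressions; `get a i` is entry `i` of the integer array `a`. -/
inductive NExp : Type
  | lit (k : ℕ)
  | get (a : ℕ) (i : NExp)
  | plus (e e' : NExp)
  | minus (e e' : NExp)

/-- Real expressions; `get a i` is entry `i` of the real array `a`. -/
inductive RExp : Type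
  | lit (q : ℚ)
  | get (a : ℕ) (i : NExp)
  | plus (e e' : RExp)
  | minus (e e' : RExp)
  | times (e e' : RExp)
  | quot (e e' : RExp)

/-- Tests. -/
inductive BExp : Type
  | natLe (e e' : NExp)
  | realLe (e e' : RExp)
  | neg (b : BExp)
  | conj (b b' : BExp)

/-- Programs; `query` is a call of the fixed-support oracle. -/
inductive Prog : Type
  | skip
  | setNat (a : ℕ) (i v : NExp)
  | setReal (a : ℕ) (i : NExp) (v : RExp)
  | seq (P P' : Prog)
  | ite (b : BExp) (P P' : Prog)
  | loop (b : BExp) (P : Prog)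
  | query

/-- The memory: `nat a i` and `real a i` are the entries `i` of the arrays with number `a`. -/
structure Memory : Type where
  nat : ℕ → ℕ → ℕ
  real : ℕ → ℕ → ℝ

namespace NExp

def eval (m : Memory) : NExp → ℕ
  | lit k => k
  | get a i => m.nat a (eval m i)
  | plus e e' => eval m e + eval m e'
  | minus e e' => eval m e - eval m e'

def cost : NExp → ℕ
  | lit _ => 1
  | get _ i => cost i + 1
  | plus e e' => cost e + cost e' + 1
  | minus e e' => cost e + cost e' + 1

end NExp

namespace RExp

noncomputable def eval (m : Memory) : RExp → ℝ
  | lit q => (q : ℝ)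
  | get a i => m.real a (i.eval m)
  | plus e e' => eval m e + eval m e'
  | minus e e' => eval m e - eval m e'
  | times e e' => eval m e * eval m e'
  | quot e e' => eval m e / eval m e'

def cost : RExp → ℕ
  | lit _ => 1
  | get _ i => i.cost + 1
  | plus e e' => cost e + cost e' + 1
  | minus e e' => cost e + cost e' + 1
  | times e e' => cost e + cost e' + 1
  | quot e e' => cost e + cost e' + 1

end RExp

namespace BExp

def holds (m : Memory) : BExp → Prop
  | natLe e e' => e.eval m ≤ e'.eval m
  | realLe e e' => e.eval m ≤ e'.eval m
  | neg b => ¬ holds m b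
  | conj b b' => holds m b ∧ holds m b'

def cost : BExp → ℕ
  | natLe e e' => e.cost + e'.cost + 1
  | realLe e e' => e.cost + e'.cost + 1
  | neg b => cost b + 1
  | conj b b' => cost b + cost b' + 1

end BExp

namespace Memory

/-- Overwrite one entry of an integer array. -/
def writeNat (m : Memory) (a i v : ℕ) : Memory where
  nat := fun a' i' => if a' = a ∧ i' = i then v else m.nat a' i'
  real := m.real

/-- Overwrite one entry of a real array. -/
noncomputable def writeReal (m : Memory) (a i : ℕ) (v : ℝ) : Memory where
  nat := m.nat
  real := fun a' i' => if a' = a ∧ i' = i then v else m.real a' i'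

/-- The initial memory for the input `(n, A)`: entry `0` of the integer array `0` is `n`, the real
array `0` holds `A` row by row (entry `(k, i)` at index `i + n * k`), all else is zero. -/
noncomputable def init {r n : ℕ} (A : Matrix (Fin r) (Fin n) ℝ) : Memory where
  nat := fun a i => if a = 0 ∧ i = 0 then n else 0
  real := fun a i =>
    if h : a = 0 ∧ i < r * n then
      A (finProdFinEquiv.symm ⟨i, h.2⟩).1 (finProdFinEquiv.symm ⟨i, h.2⟩).2
    else 0

/-- The subset of `[n]` on which the oracle is called: the integer array `1` holds its indicator
vector. -/
def queried (n : ℕ) (m : Memory) : Set (Fin n) :=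
  {i | m.nat 1 i ≠ 0}

/-- The memory after an answer of the oracle. If an optimal solution `x` with value `t` is returned,
then entry `0` of the integer array `2` becomes `1`, the first `n` entries of the real array `1`
become `x`, and entry `0` of the real array `2` becomes `t`. If the oracle certifies that there is no
optimal solution, then entry `0` of the integer array `2` becomes `0`. -/
noncomputable def receive {n : ℕ} (m : Memory) : Option ((Fin n → ℝ) × ℝ) → Memory
  | none => m.writeNat 2 0 0
  | some (x, t) =>
      { nat := (m.writeNat 2 0 1).nat
        real := fun a i =>
          if h : a = 1 ∧ i < n then x ⟨i, h.2⟩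
          else if a = 2 ∧ i = 0 then t
          else m.real a i }

/-- The output vector: the first `n` entries of the real array `3`. -/
def output (n : ℕ) (m : Memory) : Fin n → ℝ :=
  fun i => m.real 3 i

end Memory

/-- `Runs O T P m m' t`: started in memory `m`, the program `P` halts in memory `m'` after time `t`,
where calls are answered by the oracle `O` and each call is charged the time `T`. -/
inductive Runs {n : ℕ} (O : Set (Fin n) → Option ((Fin n → ℝ) × ℝ)) (T : ℕ) :
    Prog → Memory → Memory → ℕ → Prop
  | skip (m : Memory) : Runs O T Prog.skip m m 1
  | setNat (a : ℕ) (i v : NExp) (m : Memory) :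
      Runs O T (Prog.setNat a i v) m (m.writeNat a (i.eval m) (v.eval m)) (i.cost + v.cost + 1)
  | setReal (a : ℕ) (i : NExp) (v : RExp) (m : Memory) :
      Runs O T (Prog.setReal a i v) m (m.writeReal a (i.eval m) (v.eval m)) (i.cost + v.cost + 1)
  | seq (P P' : Prog) (m m' m'' : Memory) (t t' : ℕ) :
      Runs O T P m m' t → Runs O T P' m' m'' t' → Runs O T (Prog.seq P P') m m'' (t + t')
  | iteTrue (b : BExp) (P P' : Prog) (m m' : Memory) (t : ℕ) :
      b.holds m → Runs O T P m m' t → Runs O T (Prog.ite b P P') m m' (b.cost + t + 1)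
  | iteFalse (b : BExp) (P P' : Prog) (m m' : Memory) (t : ℕ) :
      ¬ b.holds m → Runs O T P' m m' t → Runs O T (Prog.ite b P P') m m' (b.cost + t + 1)
  | loopDone (b : BExp) (P : Prog) (m : Memory) :
      ¬ b.holds m → Runs O T (Prog.loop b P) m m (b.cost + 1)
  | loopStep (b : BExp) (P : Prog) (m m' m'' : Memory) (t t' : ℕ) :
      b.holds m → Runs O T P m m' t → Runs O T (Prog.loop b P) m' m'' t' →
        Runs O T (Prog.loop b P) m m'' (b.cost + t + t' + 1)
  | query (m : Memory) : Runs O T Prog.query m (m.receive (O (m.queried n))) T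

/-- `O` solves all the fixed-support problems `max {g x : x ∈ X, supp x = S}`: it returns an optimal
solution with its value if there is one, and certifies that there is none otherwise. -/
def SolvesFixedSupport {n : ℕ} (X : Set (Fin n → ℝ)) (g : (Fin n → ℝ) → ℝ)
    (O : Set (Fin n) → Option ((Fin n → ℝ) × ℝ)) : Prop :=
  ∀ S : Set (Fin n),
    (∀ x t, O S = some (x, t) →
      IsMaximizer {y | y ∈ X ∧ Function.support y = S} g x ∧ t = g x) ∧
    (O S = none → ¬ ∃ x, IsMaximizer {y | y ∈ X ∧ Function.support y = S} g x)

end Comonotone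

namespace Comonotone

/-! Reduction to candidates. Linearise `f` at the image of an optimal solution `x₀` by a subgradient
`c`. Then `x₀` maximises the linear objective `Aᵀ c`, and comonotonicity supplies another linear
maximiser `x` sorted like `Aᵀ c`, ties broken by index. The subgradient inequality makes `x` optimal
for the convex problem too. A vector sorted in this way is positive above an upper threshold,
negative below a lower one and zero between, so its support is a candidate
(`exists_candidateSupport_isMaximizer`).

Counting. The triples `(c, hi, lo)` live in dimension `r + 2`, and the support is read off the signs
of the forms `(Aᵀ c) i - hi` and `(Aᵀ c) i - lo`, except at indices tied with a threshold. An
infinitesimal `ε` removes the degeneracies: a first-order term turns the index order of tied entries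
into strict signs, and a Vandermonde term of second order makes the forms generic
(`det_pertForm_ne_zero`). The cone cut out by the resulting signs contains a nonzero point, hence a
ray on which exactly `r + 1` forms vanish (`exists_extreme_point`). By Cramer's rule the sign of
every other form there is, up to one global sign, that of its determinant with those `r + 1` forms
(`exists_det_signs`). Thus `r + 1` indices and boundedly many further choices determine the support
(`exists_configSupport`), which gives the exponent.

Algorithm. For all index tuples and all configurations, the machine marks the enumerated support,
queries the oracle and keeps the best answer. The sign of a determinant for infinitesimal `ε` is
that of its first nonzero coefficient, computed by expressions whose size depends on `r` only.
Marking therefore takes time `O(n)`, which the oracle cost absorbs. -/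

/-! ### Subgradients, sorted maximisers and thresholds. -/

theorem exists_subgradient {r : ℕ} {f : (Fin r → ℝ) → ℝ} (hf : ConvexOn ℝ Set.univ f)
    (x₀ : Fin r → ℝ) : ∃ c : Fin r → ℝ, ∀ y, f x₀ + c ⬝ᵥ (y - x₀) ≤ f y := by
  have hcont : Continuous f := by
    rw [← continuousOn_univ]
    exact hf.continuousOn isOpen_univ
  have hconv : Convex ℝ {p : (Fin r → ℝ) × ℝ | p.1 ∈ Set.univ ∧ f p.1 < p.2} :=
    hf.convex_strict_epigraph
  have hopen : IsOpen {p : (Fin r → ℝ) × ℝ | p.1 ∈ Set.univ ∧ f p.1 < p.2} := by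
    simpa using isOpen_lt (hcont.comp continuous_fst) continuous_snd
  -- Separate the strict epigraph from its boundary point `(x₀, f x₀)`. Points straight above show
  -- that the vertical coefficient `β` of the functional is negative; dividing by `-β` yields the
  -- subgradient.
  obtain ⟨F, hF⟩ := geometric_hahn_banach_open_point (x := (x₀, f x₀)) hconv hopen (by simp)
  have hdec : ∀ y t, F (y, t) = F (y, 0) + t * F (0, 1) := by
    intro y t
    have : ((y, t) : (Fin r → ℝ) × ℝ) = (y, 0) + t • (0, 1) := by simp
    rw [this, map_add, map_smul, smul_eq_mul]
  set β := F (0, 1) with hβ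
  have hβneg : β < 0 := by
    have := hF (x₀, f x₀ + 1) (by simp)
    rw [hdec, hdec x₀ (f x₀)] at this
    linarith
  have hle : ∀ y, F (y, 0) + f y * β ≤ F (x₀, 0) + f x₀ * β := by
    intro y
    refine le_of_forall_pos_le_add fun ε hε => ?_
    have := hF (y, f y + ε / (-β)) (by simpa using div_pos hε (neg_pos.2 hβneg))
    rw [hdec, hdec x₀] at this
    have h2 : ε / (-β) * β = -ε := by
      have := hβneg.ne
      field_simp
    nlinarith
  have hlin : ∀ y : Fin r → ℝ, F (y, 0) = (fun j => F (Pi.single j 1, 0)) ⬝ᵥ y := by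
    intro y
    have : ((y, 0) : (Fin r → ℝ) × ℝ) = ∑ j, y j • (Pi.single j (1 : ℝ), (0 : ℝ)) := by
      ext1
      · rw [Prod.fst_sum]
        simp only [Prod.smul_fst]
        exact pi_eq_sum_univ' y
      · simp [Prod.snd_sum]
    rw [this, map_sum]
    simp only [map_smul, smul_eq_mul, dotProduct, mul_comm]
  refine ⟨(-β)⁻¹ • fun j => F (Pi.single j 1, 0), fun y => ?_⟩
  rw [smul_dotProduct, dotProduct_sub, ← hlin, ← hlin, smul_eq_mul]
  have := hle y
  have hb : 0 < -β := by linarith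
  have h3 : (-β)⁻¹ * (F (y, 0) - F (x₀, 0)) ≤ f y - f x₀ := by
    rw [inv_mul_le_iff₀ hb]; nlinarith
  linarith

/-- A permutation sorting `v` in decreasing order, ties being broken by the index. -/
theorem exists_sorting_perm {n : ℕ} (v : Fin n → ℝ) :
    ∃ π : Equiv.Perm (Fin n), v ∈ sortedCone π ∧
      ∀ x ∈ sortedCone π, (∀ i j, v j < v i → x j ≤ x i) ∧
        ∀ i j, i < j → v i = v j → x j ≤ x i := by
  refine ⟨Tuple.sort (fun i => -v i), ?_, ?_⟩
  · intro i j hij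
    have := Tuple.monotone_sort (fun i => -v i) hij
    simpa using this
  · intro x hx
    have key : ∀ i j, -v i < -v j ∨ (-v i = -v j ∧ i < j) → x j ≤ x i := by
      intro i j h
      set σ := Tuple.sort (fun i => -v i) with hσ
      obtain ⟨hmono, hs⟩ := Tuple.eq_sort_iff.1 hσ
      have : σ.symm i < σ.symm j := by
        by_contra hcon
        have h1 := hmono (not_lt.1 hcon)
        simp only [Function.comp_apply, Equiv.apply_symm_apply] at h1
        rcases h with h | ⟨h, h'⟩
        · exact absurd h (not_lt.2 h1)
        · rcases (not_lt.1 hcon).eq_or_lt with he | hl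
          · exact h'.ne (σ.symm.injective he.symm)
          · have h2 := hs _ _ hl (by simpa using h.symm)
            simp only [Equiv.apply_symm_apply] at h2
            exact lt_asymm h' h2
      have := hx _ _ this.le
      simpa using this
    exact ⟨fun i j h => key i j (Or.inl (by linarith)),
      fun i j h h' => key i j (Or.inr ⟨by rw [h'], h⟩)⟩

/-- Every triple lies in the cell of its own sign vector, so the union over cells is a union over
all parameters. -/
theorem mem_candidateSupports {r n : ℕ} {A : Matrix (Fin r) (Fin n) ℝ} {S : Set (Fin n)} :
    S ∈ candidateSupports A ↔
      ∃ c hi lo, ∃ x ∈ thresholdSet A c hi lo, Function.support x = S := by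
  constructor
  · intro h
    simp only [candidateSupports, Set.mem_iUnion] at h
    obtain ⟨R, -, p, -, x, hx, hS⟩ := h
    exact ⟨_, _, _, x, hx, hS⟩
  · rintro ⟨c, hi, lo, x, hx, hS⟩
    simp only [candidateSupports, Set.mem_iUnion]
    let p : LiftedSpace r := (c, lo, hi)
    exact ⟨cell (liftedForm A) (fun i => SignType.sign (liftedForm A i p)),
      ⟨⟨p, fun i => rfl⟩, _, rfl⟩, p, fun i => rfl, x, hx, hS⟩

theorem exists_mem_thresholdSet {r n : ℕ} (A : Matrix (Fin r) (Fin n) ℝ) (c : Fin r → ℝ)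
    (x : Fin n → ℝ) (h₁ : ∀ i j, (Aᵀ *ᵥ c) j < (Aᵀ *ᵥ c) i → x j ≤ x i)
    (h₂ : ∀ i j, i < j → (Aᵀ *ᵥ c) i = (Aᵀ *ᵥ c) j → x j ≤ x i) :
    ∃ hi lo, x ∈ thresholdSet A c hi lo := by
  set v := Aᵀ *ᵥ c with hv
  obtain ⟨M, hM⟩ : ∃ M : ℝ, ∀ i, |v i| < M := by
    obtain ⟨M, hM⟩ := (Set.finite_range fun i => |v i|).bddAbove
    exact ⟨M + 1, fun i => by
      have : |v i| ≤ M := hM (Set.mem_range_self i)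
      linarith⟩
  have hM' : ∀ i, -M < v i ∧ v i < M := fun i => abs_lt.1 (hM i)
  -- The upper threshold is the least `v i` with `0 < x i`, and the lower one below is the greatest
  -- `v i` with `x i < 0`. If there is no such index, the default `± max M 0` lies beyond all
  -- entries; the maximum with `0` keeps `lo ≤ hi` when both defaults occur, even for `n = 0`.
  obtain ⟨hi, hhi, hhi'⟩ : ∃ hi, (∀ i, hi < v i → 0 < x i) ∧
      ((∃ i, 0 < x i ∧ v i = hi) ∨ hi = max M 0) ∧ ∀ i, v i < hi → x i ≤ 0 := by
    by_cases hp : ∃ i, 0 < x i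
    · obtain ⟨i, hi, hmin⟩ := Set.exists_min_image {i | 0 < x i} v (Set.toFinite _) hp
      refine ⟨v i, fun j hj => lt_of_lt_of_le hi (h₁ _ _ hj), Or.inl ⟨i, hi, rfl⟩, fun j hj => ?_⟩
      by_contra hcon
      exact absurd (hmin j (not_le.1 hcon)) (not_le.2 hj)
    · push Not at hp
      exact ⟨max M 0, fun i h => absurd ((hM' i).2.trans_le (le_max_left _ _)) (not_lt.2 h.le),
        Or.inr rfl, fun i _ => hp i⟩
  obtain ⟨lo, hlo, hlo'⟩ : ∃ lo, (∀ i, v i < lo → x i < 0) ∧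
      ((∃ i, x i < 0 ∧ v i = lo) ∨ lo = -max M 0) ∧ ∀ i, lo < v i → 0 ≤ x i := by
    by_cases hp : ∃ i, x i < 0
    · obtain ⟨i, hi, hmin⟩ := Set.exists_max_image {i | x i < 0} v (Set.toFinite _) hp
      refine ⟨v i, fun j hj => lt_of_le_of_lt (h₁ _ _ hj) hi, Or.inl ⟨i, hi, rfl⟩, fun j hj => ?_⟩
      by_contra hcon
      exact absurd (hmin j (not_le.1 hcon)) (not_le.2 hj)
    · push Not at hp
      refine ⟨-max M 0, fun i h => ?_, Or.inr rfl, fun i _ => hp i⟩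
      have := (hM' i).1
      have := le_max_left M 0
      linarith
  have hmax := le_max_left M 0
  have hmax' := le_max_right M 0
  refine ⟨hi, lo, ?_, fun i => ⟨hhi i, fun h => le_antisymm (hhi'.2 i h.2) (hlo'.2 i h.1), hlo i,
    fun h => hlo'.2 i (h.2.trans_eq h.1.symm), fun h => hhi'.2 i (h.1.trans_lt h.2)⟩, fun i j hij hv _ => h₂ i j hij hv⟩
  rcases hhi'.1 with ⟨i, hi1, hi2⟩ | h <;> rcases hlo'.1 with ⟨j, hj1, hj2⟩ | h'
  · by_contra hcon
    have := h₁ j i (by rw [hi2, hj2]; linarith)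
    linarith
  · have := (hM' i).1; linarith
  · have := (hM' j).2; linarith
  · linarith

/-- The subgradient inequality is used twice: at feasible points, to see that `x₀` maximises the
linearisation, and at the sorted maximiser `x`, to see that `f (A x)` is at least `f (A x₀)`. -/
theorem exists_candidateSupport_isMaximizer {r n : ℕ} (A : Matrix (Fin r) (Fin n) ℝ)
    {X : Set (Fin n → ℝ)} {f : (Fin r → ℝ) → ℝ} (hX : IsStandardComonotone X)
    (hf : ConvexOn ℝ Set.univ f) (hopt : ∃ x, IsMaximizer X (fun y => f (A.mulVec y)) x) :
    ∃ S ∈ candidateSupports A, ∃ x, IsMaximizer X (fun y => f (A.mulVec y)) x ∧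
      Function.support x = S := by
  obtain ⟨x₀, hx₀, hmax⟩ := hopt
  obtain ⟨c, hc⟩ := exists_subgradient hf (A *ᵥ x₀)
  have hdot : ∀ y, (Aᵀ *ᵥ c) ⬝ᵥ y = c ⬝ᵥ (A *ᵥ y) := fun y => by
    rw [mulVec_transpose, dotProduct_mulVec]
  obtain ⟨π, hπ, hsort⟩ := exists_sorting_perm (Aᵀ *ᵥ c)
  have hx₀' : IsMaximizer X (fun y => (Aᵀ *ᵥ c) ⬝ᵥ y) x₀ := by
    refine ⟨hx₀, fun y hy => ?_⟩
    have h1 := hc (A *ᵥ y)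
    have h2 := hmax y hy
    simp only [hdot]
    rw [dotProduct_sub] at h1
    linarith
  obtain ⟨x, hx, hxs⟩ := hX π _ hπ ⟨x₀, hx₀'⟩
  obtain ⟨hi, lo, hmem⟩ := exists_mem_thresholdSet A c x (hsort x hxs).1 (hsort x hxs).2
  refine ⟨Function.support x, mem_candidateSupports.2 ⟨c, hi, lo, x, hmem, rfl⟩, x,
    ⟨hx.1, fun y hy => ?_⟩, rfl⟩
  have h1 := hc (A *ᵥ x)
  have h2 := hmax y hy
  have h3 := hx.2 x₀ hx₀
  simp only [hdot] at h3
  rw [dotProduct_sub] at h1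
  simp only at h2 ⊢
  linarith

/-! ### Extreme rays and Cramer's rule. -/

/-- A nonzero point of a pointed polyhedral cone in dimension `m + 1` can be pushed to a ray on
which at least `m` of the defining inequalities are tight. -/
theorem exists_extreme_point {ι : Type*} [Fintype ι] {m : ℕ} (a : ι → Fin (m + 1) → ℝ)
    (hspan : ∀ w, (∀ k, a k ⬝ᵥ w = 0) → w = 0) {p : Fin (m + 1) → ℝ} (hp : p ≠ 0)
    (hpos : ∀ k, 0 ≤ a k ⬝ᵥ p) :
    ∃ w, w ≠ 0 ∧ (∀ k, 0 ≤ a k ⬝ᵥ w) ∧ m ≤ {k | a k ⬝ᵥ w = 0}.ncard := by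
  classical
  let C : Set (Fin (m + 1) → ℝ) := {w | w ≠ 0 ∧ ∀ k, 0 ≤ a k ⬝ᵥ w}
  -- Choose a nonzero point of the cone with the most tight inequalities; with fewer than `m` of
  -- them, one more can be made tight.
  obtain ⟨w, hw, hmax⟩ : ∃ w ∈ C, ∀ w' ∈ C,
      {k | a k ⬝ᵥ w' = 0}.ncard ≤ {k | a k ⬝ᵥ w = 0}.ncard := by
    have hfin : ((fun w => {k | a k ⬝ᵥ w = 0}.ncard) '' C).Finite := by
      refine (Set.finite_Iic (Fintype.card ι)).subset ?_
      rintro _ ⟨w, -, rfl⟩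
      simpa [Nat.card_eq_fintype_card] using
        Set.ncard_le_card {k | a k ⬝ᵥ w = 0}
    obtain ⟨_, ⟨w, hw, rfl⟩, h⟩ := Set.exists_max_image _ id hfin ⟨_, p, ⟨hp, hpos⟩, rfl⟩
    exact ⟨w, hw, fun w' hw' => h _ ⟨w', hw', rfl⟩⟩
  refine ⟨w, hw.1, hw.2, ?_⟩
  by_contra hlt
  push Not at hlt
  obtain ⟨j, hj⟩ : ∃ j, w j ≠ 0 := Function.ne_iff.1 hw.1
  let T := {k | a k ⬝ᵥ w = 0}
  -- A direction in the kernel keeps the tight inequalities tight and fixes the nonzero coordinate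
  -- `w j`, so that moving along it never reaches the origin.
  let φ : (Fin (m + 1) → ℝ) →ₗ[ℝ] (T → ℝ) × ℝ :=
    (LinearMap.pi fun k : T => (dotProductBilin ℝ ℝ (a k))).prod (LinearMap.proj j)
  have hφ : LinearMap.ker φ ≠ ⊥ := by
    apply LinearMap.ker_ne_bot_of_finrank_lt
    rw [Module.finrank_prod, Module.finrank_fintype_fun_eq_card, Module.finrank_self,
      Module.finrank_fintype_fun_eq_card, Fintype.card_fin, ← Nat.card_eq_fintype_card]
    exact Nat.succ_lt_succ hlt
  obtain ⟨z, hz, hz0⟩ := (Submodule.ne_bot_iff _).1 hφ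
  have hzT : ∀ k, a k ⬝ᵥ w = 0 → a k ⬝ᵥ z = 0 := fun k hk =>
    congrFun (congrArg Prod.fst (LinearMap.mem_ker.1 hz)) ⟨k, hk⟩
  have hzj : z j = 0 := congrArg Prod.snd (LinearMap.mem_ker.1 hz)
  obtain ⟨y, hyT, hyj, k₀, hk₀⟩ : ∃ y : Fin (m + 1) → ℝ, (∀ k, a k ⬝ᵥ w = 0 → a k ⬝ᵥ y = 0) ∧
      y j = 0 ∧ ∃ k, a k ⬝ᵥ y < 0 := by
    obtain ⟨k, hk⟩ : ∃ k, a k ⬝ᵥ z ≠ 0 := by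
      by_contra hcon
      push Not at hcon
      exact hz0 (hspan z hcon)
    rcases hk.lt_or_gt with h | h
    · exact ⟨z, hzT, hzj, k, h⟩
    · exact ⟨-z, fun k hk => by rw [dotProduct_neg, hzT k hk, neg_zero], by simp [hzj], k,
        by rw [dotProduct_neg]; linarith⟩
  -- Ratio test: `k₁` is the first inequality to become tight along `y`.
  obtain ⟨k₁, hk₁, hmin⟩ := Set.exists_min_image {k | a k ⬝ᵥ y < 0}
    (fun k => (a k ⬝ᵥ w) / (-(a k ⬝ᵥ y))) (Set.toFinite _) ⟨k₀, hk₀⟩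
  set t := (a k₁ ⬝ᵥ w) / (-(a k₁ ⬝ᵥ y)) with ht
  have hk₁' : a k₁ ⬝ᵥ y < 0 := hk₁
  have ht0 : 0 ≤ t := div_nonneg (hw.2 _) (by linarith)
  have hval : ∀ k, a k ⬝ᵥ (w + t • y) = a k ⬝ᵥ w + t * (a k ⬝ᵥ y) := fun k => by
    rw [dotProduct_add, dotProduct_smul, smul_eq_mul]
  have hw' : w + t • y ∈ C := by
    refine ⟨fun h => hj ?_, fun k => ?_⟩
    · simpa [hyj] using congrFun h j
    · rw [hval]
      rcases lt_or_ge (a k ⬝ᵥ y) 0 with h | h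
      · have := hmin k h
        rw [le_div_iff₀ (by linarith)] at this
        linarith
      · have := hw.2 k
        positivity
  have hlt' : {k | a k ⬝ᵥ w = 0}.ncard < {k | a k ⬝ᵥ (w + t • y) = 0}.ncard := by
    apply Set.ncard_lt_ncard _ (Set.toFinite _)
    refine ⟨fun k hk => ?_, fun hsub => ?_⟩
    · have hk' : a k ⬝ᵥ w = 0 := hk
      simp [hval, hk', hyT k hk']
    · have h0 : a k₁ ⬝ᵥ w = 0 := hsub (show a k₁ ⬝ᵥ (w + t • y) = 0 by
        have := hk₁'.ne
        rw [hval, ht]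
        field_simp
        ring)
      exact hk₁'.ne (hyT _ h0)
  exact absurd (hmax _ hw') (not_le.2 hlt')

/-- In a generic arrangement, the signs realised weakly by a nonzero point are given, up to a global
sign and off some `m` of the forms, by the determinants completing these `m` forms. -/
theorem exists_det_signs {ι : Type*} [Fintype ι] {m : ℕ} (a : ι → Fin (m + 1) → ℝ)
    (hcard : m + 1 ≤ Fintype.card ι)
    (hgen : ∀ t : Fin (m + 1) → ι, Function.Injective t → (of fun l => a (t l)).det ≠ 0)
    (σ : ι → ℝ) (hσ : ∀ k, σ k ≠ 0) {p : Fin (m + 1) → ℝ} (hp : p ≠ 0)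
    (hpos : ∀ k, 0 ≤ σ k * (a k ⬝ᵥ p)) :
    ∃ τ : Fin m → ι, ∃ s : ℝ, (s = 1 ∨ s = -1) ∧ ∀ k, k ∉ Set.range τ →
      0 < σ k * (s * (of fun l => a (Fin.snoc (α := fun _ => ι) τ k l)).det) := by
  classical
  have hzero : ∀ t : Fin (m + 1) → ι, Function.Injective t → ∀ w, (∀ l, a (t l) ⬝ᵥ w = 0) →
      w = 0 := fun t ht w hw => eq_zero_of_mulVec_eq_zero (hgen t ht) (funext hw)
  have hspan : ∀ w, (∀ k, (σ k • a k) ⬝ᵥ w = 0) → w = 0 := by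
    intro w hw
    obtain ⟨t⟩ := Function.Embedding.nonempty_of_card_le (α := Fin (m + 1)) (β := ι)
      (by simpa using hcard)
    refine hzero t t.injective w fun l => ?_
    have := hw (t l)
    rw [smul_dotProduct, smul_eq_mul] at this
    exact (mul_eq_zero.1 this).resolve_left (hσ _)
  obtain ⟨w, hw0, hw, hcardw⟩ := exists_extreme_point (fun k => σ k • a k) hspan hp
    (fun k => by rw [smul_dotProduct]; exact hpos k)
  set T := {k | (σ k • a k) ⬝ᵥ w = 0} with hT
  have hTmem : ∀ k, k ∈ T ↔ a k ⬝ᵥ w = 0 := fun k => by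
    simp [hT, smul_dotProduct, hσ k]
  -- By genericity, `m + 1` forms vanishing at `w` would force `w = 0`.
  have hTcard : T.ncard = m := by
    refine le_antisymm ?_ hcardw
    by_contra hlt
    push Not at hlt
    obtain ⟨t⟩ := Function.Embedding.nonempty_of_card_le (α := Fin (m + 1)) (β := T)
      (by rw [Fintype.card_fin, ← Nat.card_eq_fintype_card]; exact hlt)
    exact hw0 (hzero (fun l => t l) (Subtype.val_injective.comp t.injective) w
      fun l => (hTmem _).1 (t l).2)
  obtain ⟨e⟩ : Nonempty (Fin m ≃ T) := ⟨(Fintype.equivFinOfCardEq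
    (by rw [← Nat.card_eq_fintype_card]; exact hTcard)).symm⟩
  let τ : Fin m → ι := fun l => e l
  have hτ : Function.Injective τ := Subtype.val_injective.comp e.injective
  have hrange : ∀ k, k ∈ Set.range τ ↔ a k ⬝ᵥ w = 0 := fun k => by
    rw [← hTmem]
    constructor
    · rintro ⟨l, rfl⟩
      exact (e l).2
    · intro h
      exact ⟨e.symm ⟨k, h⟩, by simp [τ]⟩
  obtain ⟨j, hj⟩ : ∃ j, w j ≠ 0 := Function.ne_iff.1 hw0
  let M : (Fin (m + 1) → ℝ) → Matrix (Fin (m + 1)) (Fin (m + 1)) ℝ :=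
    fun x => of (Fin.snoc (α := fun _ => Fin (m + 1) → ℝ) (fun l => a (τ l)) x)
  have hM : ∀ k, (of fun l => a (Fin.snoc (α := fun _ => ι) τ k l)) = M (a k) := by
    intro k
    ext l i
    refine Fin.lastCases ?_ (fun l => ?_) l <;> simp [M]
  have hupd : ∀ x y, (M x).updateRow (Fin.last m) y = M y := by
    intro x y
    ext l i
    refine Fin.lastCases ?_ (fun l => ?_) l <;> simp [M, updateRow_apply, Fin.castSucc_ne_last]
  set g := (M (Pi.single j 1)).det with hg
  have hMw : ∀ k, M (a k) *ᵥ w = Pi.single (Fin.last m) (a k ⬝ᵥ w) := by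
    intro k
    ext l
    refine Fin.lastCases ?_ (fun l => ?_) l
    · simp [M, mulVec]
    · rw [Pi.single_eq_of_ne (Fin.castSucc_ne_last l)]
      simpa [M, mulVec] using (hrange _).1 ⟨l, rfl⟩
  -- Cramer's rule: the cofactor `g` belongs to the last row, the only one depending on `k`. So
  -- determinant and form value differ by the common factor `g / w j`, whose sign is the global sign
  -- `s`.
  have hdet : ∀ k, (M (a k)).det * w j = g * (a k ⬝ᵥ w) := by
    intro k
    have h1 : (M (a k)).adjugate *ᵥ (M (a k) *ᵥ w) = (M (a k)).det • w := by
      rw [mulVec_mulVec, adjugate_mul, smul_mulVec, one_mulVec]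
    have h2 := congrFun h1 j
    rw [hMw, mulVec_single, Pi.smul_apply, Pi.smul_apply, smul_eq_mul] at h2
    simp only [MulOpposite.smul_eq_mul_unop, MulOpposite.unop_op, col_apply, adjugate_apply,
      hupd] at h2
    rw [← h2]
  have hpos' : ∀ k, k ∉ Set.range τ → 0 < σ k * (a k ⬝ᵥ w) := by
    intro k hk
    have h1 := hw k
    rw [smul_dotProduct, smul_eq_mul] at h1
    exact lt_of_le_of_ne h1 (mul_ne_zero (hσ k) fun h => hk ((hrange k).2 h)).symm
  have hg0 : ∀ k, k ∉ Set.range τ → g ≠ 0 := by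
    rintro k hk h0
    have h1 := hdet k
    rw [h0, zero_mul] at h1
    refine hgen (Fin.snoc (α := fun _ => ι) τ k) (Fin.snoc_injective_iff.2 ⟨hτ, hk⟩) ?_
    rw [hM]
    exact (mul_eq_zero.1 h1).resolve_right hj
  have hdet' : ∀ k, (M (a k)).det = g / w j * (a k ⬝ᵥ w) := fun k => by
    rw [div_mul_eq_mul_div, ← hdet, mul_div_cancel_right₀ _ hj]
  refine ⟨τ, if 0 < g / w j then 1 else -1, by split_ifs <;> simp, fun k hk => ?_⟩
  have hne : g / w j ≠ 0 := div_ne_zero (hg0 k hk) hj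
  rw [hM, hdet']
  have h1 := hpos' k hk
  split_ifs with h
  · have := mul_pos h h1
    linarith
  · have h2 : 0 < -(g / w j) := by
      have := lt_of_le_of_ne (not_lt.1 h) hne
      linarith
    have := mul_pos h2 h1
    linarith

open Polynomial Filter Topology

/-! ### Signs of polynomials at infinitesimal positive arguments -/

/-- `p` is positive at all sufficiently small positive arguments. -/
def InfPos (p : ℝ[X]) : Prop := ∀ᶠ ε in 𝓝[>] (0 : ℝ), 0 < p.eval ε

theorem infPos_of_coeff_zero_pos {p : ℝ[X]} (h : 0 < p.coeff 0) : InfPos p := by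
  have hc : Tendsto (fun ε => p.eval ε) (𝓝[>] 0) (𝓝 (p.eval 0)) :=
    (p.continuous.tendsto 0).mono_left nhdsWithin_le_nhds
  rw [← coeff_zero_eq_eval_zero] at hc
  exact hc.eventually (lt_mem_nhds h)

theorem infPos_X_mul {p : ℝ[X]} : InfPos (X * p) ↔ InfPos p := by
  refine eventually_congr ?_
  filter_upwards [self_mem_nhdsWithin] with ε hε
  rw [eval_mul, eval_X]
  exact mul_pos_iff_of_pos_left hε

theorem InfPos.not_neg {p : ℝ[X]} (h : InfPos p) : ¬ InfPos (-p) := by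
  intro h'
  obtain ⟨ε, h1, h2⟩ := (h.and h').exists
  rw [eval_neg] at h2
  linarith

/-- Split off the largest power of `X`; the nonzero constant coefficient of the cofactor decides the
sign. -/
theorem infPos_trichotomy (p : ℝ[X]) : p = 0 ∨ InfPos p ∨ InfPos (-p) := by
  refine or_iff_not_imp_left.2 fun hp => ?_
  obtain ⟨q, hq, hq'⟩ := exists_eq_pow_rootMultiplicity_mul_and_not_dvd p hp 0
  simp only [C_0, sub_zero, X_dvd_iff] at hq hq'
  have key : ∀ (m : ℕ) (s : ℝ[X]), InfPos s → InfPos (X ^ m * s) := by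
    intro m s hs
    induction m with
    | zero => simpa
    | succ m ih => rw [pow_succ', mul_assoc, infPos_X_mul]; exact ih
  rcases lt_or_gt_of_ne hq' with h | h
  · right
    rw [hq, ← mul_neg]
    exact key _ _ (infPos_of_coeff_zero_pos (by simpa using h))
  · left
    rw [hq]
    exact key _ _ (infPos_of_coeff_zero_pos h)

theorem eventually_eval_pos_iff (p : ℝ[X]) :
    ∀ᶠ ε in 𝓝[>] (0 : ℝ), (0 < p.eval ε ↔ InfPos p) := by
  rcases infPos_trichotomy p with rfl | h | h
  · have : ¬ InfPos 0 := fun h => h.not_neg (by simpa using h)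
    simp [this]
  · filter_upwards [h] with ε hε
    simp [hε, h]
  · filter_upwards [h] with ε hε
    have hn : ¬ InfPos p := fun h' => h'.not_neg h
    rw [eval_neg] at hε
    simp only [hn, iff_false]
    linarith

theorem eventually_eval_ne_zero {p : ℝ[X]} (hp : p ≠ 0) :
    ∀ᶠ ε in 𝓝[>] (0 : ℝ), p.eval ε ≠ 0 := by
  rcases infPos_trichotomy p with h | h | h
  · exact absurd h hp
  · filter_upwards [h] with ε hε using hε.ne'
  · filter_upwards [h] with ε hε h0
    simp [h0] at hε

/-- The generic second-order perturbation, which enters through `R`, cannot alter signs settled at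
order zero or one. -/
theorem eventually_pos_of_lex {b₀ b₁ : ℝ} {R : ℝ → ℝ} (hR : Continuous R)
    (h : 0 < b₀ ∨ b₀ = 0 ∧ 0 < b₁) :
    ∀ᶠ ε in 𝓝[>] (0 : ℝ), 0 < b₀ + b₁ * ε + R ε * ε ^ 2 := by
  rcases h with h | ⟨rfl, h⟩
  · have hc : Continuous fun ε => b₀ + b₁ * ε + R ε * ε ^ 2 := by fun_prop
    have := (hc.tendsto 0).mono_left (nhdsWithin_le_nhds (s := Set.Ioi 0))
    exact this.eventually (lt_mem_nhds (by simpa using h))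
  · have hc : Continuous fun ε => b₁ + R ε * ε := by fun_prop
    have := (hc.tendsto 0).mono_left (nhdsWithin_le_nhds (s := Set.Ioi 0))
    filter_upwards [this.eventually (lt_mem_nhds (a := 0) (by simpa using h)),
      self_mem_nhdsWithin] with ε h1 h2
    have h3 : 0 < ε * (b₁ + R ε * ε) := mul_pos h2 h1
    linarith

/-! ### The perturbed arrangement -/

/-- Distinct weights for the forms; on each of the three blocks they increase with the index. -/
def weight {n : ℕ} (k : Fin n × Fin 3) : ℝ := 3 * (k.1 : ℕ) + (k.2 : ℕ)

theorem weight_injective {n : ℕ} : Function.Injective (weight (n := n)) := by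
  rintro ⟨i, b⟩ ⟨j, b'⟩ h
  have h' : 3 * (i : ℕ) + (b : ℕ) = 3 * (j : ℕ) + (b' : ℕ) := by
    simp only [weight] at h
    exact_mod_cast h
  have := b.2
  have := b'.2
  ext <;> simp only <;> omega

/-- The unperturbed forms `κ (Aᵀ c) i - hi`, `κ (Aᵀ c) i - lo`, `κ (Aᵀ c) i` in `(c, hi, lo)`. -/
def baseCoeff {r n : ℕ} (A : Matrix (Fin r) (Fin n) ℝ) (κ : ℚ) (k : Fin n × Fin 3) :
    Fin (r + 2) → ℝ :=
  Fin.snoc (α := fun _ => ℝ) (Fin.snoc (α := fun _ => ℝ) (fun j => κ * A j k.1)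
    (if k.2 = 0 then -1 else 0)) (if k.2 = 1 then -1 else 0)

/-- The first-order perturbation, which breaks ties by the index if `c ⬝ᵥ u > 0`. -/
def slopeCoeff {r n : ℕ} (u : Fin r → ℚ) (k : Fin n × Fin 3) : Fin (r + 2) → ℝ :=
  Fin.snoc (α := fun _ => ℝ) (Fin.snoc (α := fun _ => ℝ) (fun j => -(u j : ℝ) * weight k) 0) 0

/-- The perturbed forms; the second-order perturbation makes the arrangement generic. -/
noncomputable def pertForm {r n : ℕ} (A : Matrix (Fin r) (Fin n) ℝ) (κ : ℚ) (u : Fin r → ℚ)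
    (k : Fin n × Fin 3) (j : Fin (r + 2)) : ℝ[X] :=
  C (baseCoeff A κ k j) + C (slopeCoeff u k j) * X + C (weight k ^ (j : ℕ)) * X ^ 2

theorem eval_pertForm {r n : ℕ} (A : Matrix (Fin r) (Fin n) ℝ) (κ : ℚ) (u : Fin r → ℚ)
    (k : Fin n × Fin 3) (j : Fin (r + 2)) (ε : ℝ) : (pertForm A κ u k j).eval ε =
      baseCoeff A κ k j + slopeCoeff u k j * ε + weight k ^ (j : ℕ) * ε ^ 2 := by
  simp [pertForm]

/-- The determinant of the forms selected by `τ` and the form `k`. -/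
noncomputable def tupleDet {r n : ℕ} (A : Matrix (Fin r) (Fin n) ℝ) (κ : ℚ) (u : Fin r → ℚ)
    (τ : Fin (r + 1) → Fin n × Fin 3) (k : Fin n × Fin 3) : ℝ[X] :=
  (of fun l j => pertForm A κ u (Fin.snoc (α := fun _ => Fin n × Fin 3) τ k l) j).det

theorem eval_det_of {d : ℕ} (M : Fin d → Fin d → ℝ[X]) (ε : ℝ) :
    (of M).det.eval ε = (of fun l j => (M l j).eval ε).det := by
  rw [← coe_evalRingHom, RingHom.map_det]
  rfl

/-- Substitute `ε = 1 / δ` and multiply the entries by `δ ^ 2`. As `δ` tends to `0` only the weight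
powers remain, a Vandermonde matrix with distinct nodes. -/
theorem det_pertForm_ne_zero {r n : ℕ} (A : Matrix (Fin r) (Fin n) ℝ) (κ : ℚ) (u : Fin r → ℚ)
    (t : Fin (r + 2) → Fin n × Fin 3) (ht : Function.Injective t) :
    (of fun l j => pertForm A κ u (t l) j).det ≠ 0 := by
  intro h0
  let N : ℝ → Matrix (Fin (r + 2)) (Fin (r + 2)) ℝ := fun δ => of fun l j =>
    baseCoeff A κ (t l) j * δ ^ 2 + slopeCoeff u (t l) j * δ + weight (t l) ^ (j : ℕ)
  have hN : ∀ δ : ℝ, δ ≠ 0 → (N δ).det = 0 := by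
    intro δ hδ
    have h1 : N δ = δ ^ 2 • of fun l j => (pertForm A κ u (t l) j).eval δ⁻¹ := by
      ext l j
      simp only [N, of_apply, Matrix.smul_apply, eval_pertForm, smul_eq_mul]
      field_simp
    rw [h1, det_smul, ← eval_det_of, h0, eval_zero, mul_zero]
  have hcont : Continuous fun δ => (N δ).det := by
    refine Continuous.matrix_det (continuous_matrix fun l j => ?_)
    simp only [N, of_apply]
    fun_prop
  have hN0 : (N 0).det = 0 := by
    have h1 : (fun δ => (N δ).det) =ᶠ[𝓝[≠] 0] fun _ => 0 := by
      filter_upwards [self_mem_nhdsWithin] with δ hδ using hN δ hδ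
    exact tendsto_nhds_unique ((hcont.tendsto 0).mono_left nhdsWithin_le_nhds)
      (tendsto_const_nhds.congr' h1.symm)
  have hV : N 0 = vandermonde fun l => weight (t l) := by
    ext l j
    simp [N, vandermonde_apply]
  rw [hV] at hN0
  exact det_vandermonde_ne_zero_iff.2 (weight_injective.comp ht) hN0

theorem pertForm_dotProduct {r n : ℕ} (A : Matrix (Fin r) (Fin n) ℝ) (κ : ℚ) (u : Fin r → ℚ)
    (k : Fin n × Fin 3) (c : Fin r → ℝ) (h h' q q' ε : ℝ) :
    (fun j => (pertForm A κ u k j).eval ε) ⬝ᵥ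
      Fin.snoc (α := fun _ => ℝ) (Fin.snoc (α := fun _ => ℝ) c (h + q * ε)) (h' + q' * ε) =
    (∑ j, κ * A j k.1 * c j + (if k.2 = 0 then -h else 0) + (if k.2 = 1 then -h' else 0)) +
      (-(∑ j, (u j : ℝ) * c j) * weight k + (if k.2 = 0 then -q else 0) +
        (if k.2 = 1 then -q' else 0)) * ε +
      (∑ j : Fin (r + 2), weight k ^ (j : ℕ) * Fin.snoc (α := fun _ => ℝ)
        (Fin.snoc (α := fun _ => ℝ) c (h + q * ε)) (h' + q' * ε) j) * ε ^ 2 := by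
  simp only [dotProduct, eval_pertForm, add_mul, Finset.sum_add_distrib]
  congr 1
  · simp only [Fin.sum_univ_castSucc, baseCoeff, slopeCoeff, Fin.snoc_castSucc, Fin.snoc_last]
    have : ∑ j, -(u j : ℝ) * weight k * ε * c j = -(∑ j, (u j : ℝ) * c j) * weight k * ε := by
      rw [← Finset.sum_neg_distrib, Finset.sum_mul, Finset.sum_mul]
      exact Finset.sum_congr rfl fun j _ => by ring
    rw [this]
    split_ifs <;> ring
  · rw [Finset.sum_mul]
    exact Finset.sum_congr rfl fun j _ => by ring

/-! ### The enumerated supports -/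

/-- The support guessed from the forms selected by `τ`, the membership `g` of their indices, and
the global sign `s`. -/
def enumSupport {r n : ℕ} (A : Matrix (Fin r) (Fin n) ℝ) (κ : ℚ) (u : Fin r → ℚ) (s : ℚ)
    (g : Fin (r + 1) → Bool) (τ : Fin (r + 1) → Fin n × Fin 3) : Set (Fin n) :=
  {i | (∃ j, (τ j).1 = i ∧ g j = true) ∨ InfPos (C (s : ℝ) * tupleDet A κ u τ (i, 0)) ∨
    InfPos (C (-s : ℝ) * tupleDet A κ u τ (i, 1))}

theorem exists_threshold {n : ℕ} (U L : Set (Fin n)) (w : Fin n → ℝ)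
    (h : ∀ i ∈ U, ∀ j ∈ L, w i < w j) : ∃ a, (∀ i ∈ U, w i < a) ∧ ∀ j ∈ L, a < w j := by
  classical
  obtain ⟨a, h1, h2⟩ := Order.exists_between_finsets (U.toFinite.toFinset.image w)
    (L.toFinite.toFinset.image w) (by
      simp only [Finset.mem_image, Set.Finite.mem_toFinset]
      rintro _ ⟨i, hi, rfl⟩ _ ⟨j, hj, rfl⟩
      exact h i hi j hj)
  simp only [Finset.mem_image, Set.Finite.mem_toFinset] at h1 h2
  exact ⟨a, fun i hi => h1 _ ⟨i, hi, rfl⟩, fun i hi => h2 _ ⟨i, hi, rfl⟩⟩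

/-- The thresholds are shifted at first order in `ε`, so that each form of blocks `0` and `1` gets
the strict sign dictated by `x`; the extreme ray of the resulting cone then encodes the support. The
vector `c` is kept apart from `c₀` so that it can be nonzero when `c₀ = 0`. -/
theorem exists_enumSupport_of_dotProduct_pos {r n : ℕ} (A : Matrix (Fin r) (Fin n) ℝ)
    (hn : r + 2 ≤ n * 3) (κ : ℚ) (u : Fin r → ℚ) (c : Fin r → ℝ)
    (hcu : 0 < ∑ j, (u j : ℝ) * c j) (c₀ : Fin r → ℝ)
    (hv : ∀ i, ∑ j, κ * A j i * c j = (Aᵀ *ᵥ c₀) i) (hi lo : ℝ) (x : Fin n → ℝ)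
    (hx : x ∈ thresholdSet A c₀ hi lo) :
    ∃ s : ℚ, (s = 1 ∨ s = -1) ∧ ∃ g τ, Function.support x = enumSupport A κ u s g τ := by
  classical
  obtain ⟨hle, hsign, hord⟩ := hx
  set v := Aᵀ *ᵥ c₀
  have hpos1 : ∀ i, 0 < x i → hi ≤ v i := fun i h => by
    by_contra hcon
    push Not at hcon
    obtain ⟨-, h2, h3, -, h5⟩ := hsign i
    rcases lt_trichotomy (v i) lo with h' | h' | h'
    · linarith [h3 h']
    · linarith [h5 ⟨h', h' ▸ hcon⟩]
    · linarith [h2 ⟨h', hcon⟩]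
  have hpos2 : ∀ i, x i ≤ 0 → v i ≤ hi := fun i h => by
    by_contra hcon
    push Not at hcon
    linarith [(hsign i).1 hcon]
  have hneg1 : ∀ i, x i < 0 → v i ≤ lo := fun i h => by
    by_contra hcon
    push Not at hcon
    obtain ⟨h1, h2, -, h4, -⟩ := hsign i
    rcases lt_trichotomy (v i) hi with h' | h' | h'
    · linarith [h2 ⟨hcon, h'⟩]
    · linarith [h4 ⟨h', h' ▸ hcon⟩]
    · linarith [h1 h']
  have hneg2 : ∀ i, 0 ≤ x i → lo ≤ v i := fun i h => by
    by_contra hcon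
    push Not at hcon
    linarith [(hsign i).2.2.1 hcon]
  have hw : ∀ (b : Fin 3) (i j : Fin n), ¬ j < i → i ≠ j → weight (i, b) < weight (j, b) := by
    intro b i j hij hne
    have h1 : (i : ℕ) < j := lt_of_le_of_ne (not_lt.1 hij) fun h => hne (Fin.ext h)
    have h2 : ((i : ℕ) : ℝ) < ((j : ℕ) : ℝ) := by exact_mod_cast h1
    simp only [weight]
    linarith
  -- Among indices tied at `hi`, the ordering constraint puts the positive entries first, so a cut
  -- `a` of the weights separates them. Likewise `a'` separates the negative entries tied at `lo`.
  obtain ⟨a, ha1, ha2⟩ := exists_threshold {i | v i = hi ∧ 0 < x i} {i | v i = hi ∧ x i ≤ 0}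
    (fun i => weight (i, 0)) (by
      rintro i ⟨h1, h2⟩ j ⟨h3, h4⟩
      refine hw _ _ _ (fun h => ?_) (fun h => ?_)
      · linarith [hord j i h (h3.trans h1.symm) (Or.inl h3)]
      · rw [h] at h2; linarith)
  obtain ⟨a', ha1', ha2'⟩ := exists_threshold {i | v i = lo ∧ 0 ≤ x i} {i | v i = lo ∧ x i < 0}
    (fun i => weight (i, 1)) (by
      rintro i ⟨h1, h2⟩ j ⟨h3, h4⟩
      refine hw _ _ _ (fun h => ?_) (fun h => ?_)
      · linarith [hord j i h (h3.trans h1.symm) (Or.inr h3)]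
      · rw [h] at h2; linarith)
  set ρ := ∑ j, (u j : ℝ) * c j with hρ
  -- With these shifts a form tied at `hi` has first-order coefficient `ρ * (a - weight)`, and one
  -- tied at `lo` has `ρ * (a' - weight)`; positivity of `ρ` makes the cuts decide the signs.
  let p : ℝ → Fin (r + 2) → ℝ := fun ε => Fin.snoc (α := fun _ => ℝ) (Fin.snoc (α := fun _ => ℝ) c
    (hi + (-(ρ * a)) * ε)) (lo + (-(ρ * a')) * ε)
  have hpc : Continuous p := by
    refine continuous_pi fun j => ?_
    refine Fin.lastCases ?_ (fun j => Fin.lastCases ?_ (fun j => ?_) j) j <;>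
      simp only [p, Fin.snoc_castSucc, Fin.snoc_last] <;> fun_prop
  let σ₀ : Fin n → ℝ := fun i => if 0 < x i then 1 else -1
  let σ₁ : Fin n → ℝ := fun i => if x i < 0 then -1 else 1
  have hev0 : ∀ i, ∀ᶠ ε in 𝓝[>] (0 : ℝ),
      0 < σ₀ i * ((fun j => (pertForm A κ u (i, 0) j).eval ε) ⬝ᵥ p ε) := by
    intro i
    have h := eventually_pos_of_lex (b₀ := σ₀ i * (v i - hi))
      (b₁ := σ₀ i * (ρ * (a - weight (i, 0))))
      (R := fun ε => σ₀ i * ∑ j : Fin (r + 2), weight (i, (0 : Fin 3)) ^ (j : ℕ) * p ε j)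
      (by fun_prop) (by
        simp only [σ₀]
        split_ifs with h
        · rcases (hpos1 i h).eq_or_lt with h' | h'
          · right
            have := mul_pos hcu (sub_pos.2 (ha1 i ⟨h'.symm, h⟩))
            exact ⟨by rw [h']; ring, by linarith⟩
          · left; linarith
        · rcases (hpos2 i (not_lt.1 h)).eq_or_lt with h' | h'
          · right
            have := mul_pos hcu (sub_pos.2 (ha2 i ⟨h', not_lt.1 h⟩))
            exact ⟨by rw [h']; ring, by linarith⟩
          · left; linarith)
    filter_upwards [h] with ε hε
    rw [pertForm_dotProduct, ← hρ, hv]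
    simp only [if_true, if_neg (show (0 : Fin 3) ≠ 1 by decide)]
    convert hε using 1
    ring
  have hev1 : ∀ i, ∀ᶠ ε in 𝓝[>] (0 : ℝ),
      0 < σ₁ i * ((fun j => (pertForm A κ u (i, 1) j).eval ε) ⬝ᵥ p ε) := by
    intro i
    have h := eventually_pos_of_lex (b₀ := σ₁ i * (v i - lo))
      (b₁ := σ₁ i * (ρ * (a' - weight (i, 1))))
      (R := fun ε => σ₁ i * ∑ j : Fin (r + 2), weight (i, (1 : Fin 3)) ^ (j : ℕ) * p ε j)
      (by fun_prop) (by
        simp only [σ₁]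
        split_ifs with h
        · rcases (hneg1 i h).eq_or_lt with h' | h'
          · right
            have := mul_pos hcu (sub_pos.2 (ha2' i ⟨h', h⟩))
            exact ⟨by rw [h']; ring, by linarith⟩
          · left; linarith
        · rcases (hneg2 i (not_lt.1 h)).eq_or_lt with h' | h'
          · right
            have := mul_pos hcu (sub_pos.2 (ha1' i ⟨h'.symm, not_lt.1 h⟩))
            exact ⟨by rw [h']; ring, by linarith⟩
          · left; linarith)
    filter_upwards [h] with ε hε
    rw [pertForm_dotProduct, ← hρ, hv]
    simp only [if_true, if_neg (show (1 : Fin 3) ≠ 0 by decide)]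
    convert hε using 1
    ring
  -- Only finitely many polynomials occur, so a single `ε` is generic and also shows all their
  -- infinitesimal signs.
  have hgen : ∀ᶠ ε in 𝓝[>] (0 : ℝ), ∀ t : Fin (r + 2) → Fin n × Fin 3, Function.Injective t →
      (of fun l j => (pertForm A κ u (t l) j).eval ε).det ≠ 0 := by
    refine eventually_all.2 fun t => ?_
    by_cases ht : Function.Injective t
    · filter_upwards [eventually_eval_ne_zero (det_pertForm_ne_zero A κ u t ht)] with ε hε _
      rwa [eval_det_of] at hε
    · exact Eventually.of_forall fun ε h => absurd h ht
  have hiff : ∀ᶠ ε in 𝓝[>] (0 : ℝ), ∀ (τ : Fin (r + 1) → Fin n × Fin 3) (k : Fin n × Fin 3)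
      (b : Bool), (0 < (C (if b then (1 : ℝ) else -1) * tupleDet A κ u τ k).eval ε ↔
        InfPos (C (if b then (1 : ℝ) else -1) * tupleDet A κ u τ k)) :=
    eventually_all.2 fun τ => eventually_all.2 fun k => eventually_all.2 fun b =>
      eventually_eval_pos_iff _
  obtain ⟨ε, h0, h1, hgen, hiff⟩ :=
    ((eventually_all.2 hev0).and ((eventually_all.2 hev1).and (hgen.and hiff))).exists
  have hiff' : ∀ s : ℝ, (s = 1 ∨ s = -1) → ∀ τ k,
      (0 < s * (tupleDet A κ u τ k).eval ε ↔ InfPos (C s * tupleDet A κ u τ k)) := by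
    rintro s (rfl | rfl) τ k
    · simpa using hiff τ k true
    · simpa using hiff τ k false
  let a₂ : Fin n × Fin 3 → Fin (r + 2) → ℝ := fun k j => (pertForm A κ u k j).eval ε
  -- Block `2` carries no information and takes whatever sign fits `p ε`. It only ensures `r + 2`
  -- forms, since `2 * n` falls short when `n = 1`.
  let σ : Fin n × Fin 3 → ℝ := fun k =>
    if k.2 = 0 then σ₀ k.1 else if k.2 = 1 then σ₁ k.1 else if 0 ≤ a₂ k ⬝ᵥ p ε then 1 else -1
  have hσ0 : ∀ i, σ (i, 0) = σ₀ i := fun i => by simp [σ]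
  have hσ1 : ∀ i, σ (i, 1) = σ₁ i := fun i => by simp [σ]
  obtain ⟨τ, s, hs, hτ⟩ := exists_det_signs a₂ (m := r + 1) (by simp; omega) hgen σ
    (by
      intro k
      simp only [σ, σ₀, σ₁]
      split_ifs <;> norm_num)
    (p := p ε) (by
      intro h
      have hc : c = 0 := by
        ext j
        have := congrFun h (Fin.castSucc (Fin.castSucc j))
        simpa [p] using this
      simp [hρ, hc] at hcu)
    (by
      rintro ⟨i, b⟩
      fin_cases b
      · exact (by simpa [hσ0] using h0 i : _ < _).le
      · exact (by simpa [hσ1] using h1 i : _ < _).le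
      · have h2 : ((2 : Fin 3) = 0) = False := by decide
        have h3 : ((2 : Fin 3) = 1) = False := by decide
        simp only [σ, Fin.reduceFinMk, h2, h3, if_false]
        split_ifs with h
        · linarith
        · linarith)
  have hdet : ∀ k, (of fun l => a₂ (Fin.snoc (α := fun _ => Fin n × Fin 3) τ k l)).det =
      (tupleDet A κ u τ k).eval ε := fun k => by
    rw [tupleDet, eval_det_of]
  simp only [hdet] at hτ
  -- A repeated row: the determinants say nothing about the selected forms, which is why membership
  -- of their indices is recorded in `g`.
  have hrep : ∀ k, k ∈ Set.range τ → (tupleDet A κ u τ k).eval ε = 0 := by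
    rintro _ ⟨l, rfl⟩
    rw [← hdet]
    refine det_zero_of_row_eq (Fin.castSucc_ne_last l) ?_
    ext j
    simp
  -- Positive entries are seen by a positive form of block `0`, negative ones by a negative form of
  -- block `1`; hence the opposite signs.
  have main : ∀ s : ℝ, (s = 1 ∨ s = -1) → (∀ k, k ∉ Set.range τ →
      0 < σ k * (s * (tupleDet A κ u τ k).eval ε)) → ∀ i,
      (x i ≠ 0 ↔ (∃ j, (τ j).1 = i ∧ decide (x (τ j).1 ≠ 0) = true) ∨
        InfPos (C s * tupleDet A κ u τ (i, 0)) ∨ InfPos (C (-s) * tupleDet A κ u τ (i, 1))) := by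
    intro s hs hτ i
    have hs' : -s = 1 ∨ -s = -1 := by
      rcases hs with rfl | rfl <;> simp
    rw [← hiff' _ hs, ← hiff' _ hs']
    have k0 := hτ (i, 0)
    have k1 := hτ (i, 1)
    rw [hσ0] at k0
    rw [hσ1] at k1
    simp only [σ₀] at k0
    simp only [σ₁] at k1
    constructor
    · intro hxi
      have first : ∀ b, (i, b) ∈ Set.range τ →
          ∃ j, (τ j).1 = i ∧ decide (x (τ j).1 ≠ 0) = true := by
        rintro b ⟨j, hj⟩
        exact ⟨j, by rw [hj], by simpa [hj] using hxi⟩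
      rcases lt_or_gt_of_ne hxi with h | h
      · by_cases hm : (i, (1 : Fin 3)) ∈ Set.range τ
        · exact Or.inl (first _ hm)
        · have := k1 hm
          rw [if_pos h] at this
          right; right; linarith
      · by_cases hm : (i, (0 : Fin 3)) ∈ Set.range τ
        · exact Or.inl (first _ hm)
        · have := k0 hm
          rw [if_pos h] at this
          right; left; linarith
    · rintro (⟨j, rfl, hj⟩ | h | h)
      · simpa using hj
      · have hm : (i, (0 : Fin 3)) ∉ Set.range τ := fun hm => by
          rw [hrep _ hm] at h; simp at h
        have := k0 hm
        split_ifs at this with h'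
        · exact h'.ne'
        · linarith
      · have hm : (i, (1 : Fin 3)) ∉ Set.range τ := fun hm => by
          rw [hrep _ hm] at h; simp at h
        have := k1 hm
        split_ifs at this with h'
        · exact h'.ne
        · linarith
  rcases hs with rfl | rfl
  · refine ⟨1, Or.inl rfl, fun j => decide (x (τ j).1 ≠ 0), τ, ?_⟩
    ext i
    simpa [enumSupport] using main 1 (Or.inl rfl) hτ i
  · refine ⟨-1, Or.inr rfl, fun j => decide (x (τ j).1 ≠ 0), τ, ?_⟩
    ext i
    simpa [enumSupport] using main (-1) (Or.inr rfl) hτ i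

/-- The finitely many choices, apart from the tuple, that determine an enumerated support. -/
abbrev Config (r : ℕ) : Type :=
  Bool × (Fin r × Bool) × Bool × (Fin (r + 1) → Bool) × (Fin (r + 1) → Fin 3)

/-- The sign encoded by a Boolean. -/
def signOf (b : Bool) : ℚ := if b then 1 else -1

/-- The support enumerated for the configuration `γ` and the indices `τ`. -/
def configSupport {r n : ℕ} (A : Matrix (Fin r) (Fin n) ℝ) (γ : Config r)
    (τ : Fin (r + 1) → Fin n) : Set (Fin n) :=
  enumSupport A (if γ.1 then 1 else 0) (Pi.single γ.2.1.1 (signOf γ.2.1.2)) (signOf γ.2.2.1)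
    γ.2.2.2.1 fun j => (τ j, γ.2.2.2.2 j)

theorem exists_configSupport {r n : ℕ} (hr : 1 ≤ r) (hrn : r ≤ n) (A : Matrix (Fin r) (Fin n) ℝ)
    {S : Set (Fin n)} (hS : S ∈ candidateSupports A) : ∃ γ τ, S = configSupport A γ τ := by
  obtain ⟨c, hi, lo, x, hx, rfl⟩ := mem_candidateSupports.1 hS
  have hn : r + 2 ≤ n * 3 := by omega
  have key : ∀ (κ : Bool) (j₀ : Fin r) (b : Bool) (c' : Fin r → ℝ), 0 < signOf b * c' j₀ →
      (∀ i, ∑ j, (if κ then (1 : ℚ) else 0 : ℚ) * A j i * c' j = (Aᵀ *ᵥ c) i) →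
      ∃ γ τ, Function.support x = configSupport A γ τ := by
    intro κ j₀ b c' hpos hv
    obtain ⟨s, hs, g, τ, h⟩ := exists_enumSupport_of_dotProduct_pos A hn _
      (Pi.single j₀ (signOf b)) c' (by
        rw [Finset.sum_eq_single j₀]
        · simpa using hpos
        · intro j _ hj
          simp [Pi.single_eq_of_ne hj]
        · simp) c hv hi lo x hx
    obtain ⟨b', hb'⟩ : ∃ b', s = signOf b' := by
      rcases hs with rfl | rfl
      · exact ⟨true, rfl⟩
      · exact ⟨false, rfl⟩
    exact ⟨(κ, (j₀, b), b', g, fun j => (τ j).2), fun j => (τ j).1, by rw [h, hb']; rfl⟩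
  by_cases hc : c = 0
  -- No `u` satisfies `c ⬝ᵥ u > 0` when `c = 0`. Setting `κ = 0` removes `A` and frees the vector,
  -- replaced by the all-ones vector. If `c ≠ 0`, a signed unit vector at a nonzero coordinate
  -- serves as `u`.
  · refine key false ⟨0, hr⟩ true (fun _ => 1) (by simp [signOf]) fun i => ?_
    simp [hc]
  · obtain ⟨j, hj⟩ := Function.ne_iff.1 hc
    have hv : ∀ i, ∑ j, (if true then (1 : ℚ) else 0 : ℚ) * A j i * c j = (Aᵀ *ᵥ c) i := by
      intro i
      simp [mulVec, dotProduct]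
    rcases lt_or_gt_of_ne hj with h | h
    · exact key true j false c (by simpa [signOf] using h) hv
    · exact key true j true c (by simpa [signOf] using h) hv

theorem ncard_candidateSupports_le {r n : ℕ} (hr : 1 ≤ r) (hrn : r ≤ n)
    (A : Matrix (Fin r) (Fin n) ℝ) :
    (candidateSupports A).ncard ≤ Fintype.card (Config r) * n ^ (r + 1) := by
  have hsub : candidateSupports A ⊆
      (fun q : Config r × (Fin (r + 1) → Fin n) => configSupport A q.1 q.2) '' Set.univ := by
    intro S hS
    obtain ⟨γ, τ, h⟩ := exists_configSupport hr hrn A hS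
    exact ⟨(γ, τ), trivial, h.symm⟩
  refine (Set.ncard_le_ncard hsub (Set.toFinite _)).trans
    ((Set.ncard_image_le Set.finite_univ).trans ?_)
  rw [Set.ncard_univ, Nat.card_eq_fintype_card, Fintype.card_prod, Fintype.card_fun,
    Fintype.card_fin, Fintype.card_fin]

/-! ### Executions with a time bound -/

namespace Memory

@[simp] theorem nat_writeNat (m : Memory) (a i v a' i' : ℕ) :
    (m.writeNat a i v).nat a' i' = if a' = a ∧ i' = i then v else m.nat a' i' := rfl

@[simp] theorem real_writeNat (m : Memory) (a i v : ℕ) : (m.writeNat a i v).real = m.real := rfl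

@[simp] theorem nat_writeReal (m : Memory) (a i : ℕ) (v : ℝ) : (m.writeReal a i v).nat = m.nat :=
  rfl

@[simp] theorem real_writeReal (m : Memory) (a i : ℕ) (v : ℝ) (a' i' : ℕ) :
    (m.writeReal a i v).real a' i' = if a' = a ∧ i' = i then v else m.real a' i' := rfl

end Memory

/-- Started in `m`, the program `P` halts within time `c` in a memory satisfying `Q`. -/
def Exec {n : ℕ} (O : Set (Fin n) → Option ((Fin n → ℝ) × ℝ)) (T : ℕ) (P : Prog) (m : Memory)
    (c : ℕ) (Q : Memory → Prop) : Prop :=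
  ∃ m' t, Runs O T P m m' t ∧ t ≤ c ∧ Q m'

namespace Exec

variable {n : ℕ} {O : Set (Fin n) → Option ((Fin n → ℝ) × ℝ)} {T : ℕ} {P P' : Prog}
  {m : Memory} {c c' : ℕ} {Q Q' : Memory → Prop}

theorem mono (h : Exec O T P m c Q) (hc : c ≤ c') (hQ : ∀ m', Q m' → Q' m') :
    Exec O T P m c' Q' := by
  obtain ⟨m', t, h1, h2, h3⟩ := h
  exact ⟨m', t, h1, h2.trans hc, hQ _ h3⟩

theorem skip (hQ : Q m) : Exec O T Prog.skip m 1 Q := ⟨m, 1, .skip m, le_rfl, hQ⟩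

theorem setNat {a : ℕ} {i v : NExp} (hQ : Q (m.writeNat a (i.eval m) (v.eval m))) :
    Exec O T (Prog.setNat a i v) m (i.cost + v.cost + 1) Q :=
  ⟨_, _, .setNat a i v m, le_rfl, hQ⟩

theorem setReal {a : ℕ} {i : NExp} {v : RExp}
    (hQ : Q (m.writeReal a (i.eval m) (v.eval m))) :
    Exec O T (Prog.setReal a i v) m (i.cost + v.cost + 1) Q :=
  ⟨_, _, .setReal a i v m, le_rfl, hQ⟩

theorem query (hQ : Q (m.receive (O (m.queried n)))) : Exec O T Prog.query m T Q :=
  ⟨_, _, .query m, le_rfl, hQ⟩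

theorem seq (h : Exec O T P m c Q) (h' : ∀ m', Q m' → Exec O T P' m' c' Q') :
    Exec O T (Prog.seq P P') m (c + c') Q' := by
  obtain ⟨m₁, t₁, h1, h2, h3⟩ := h
  obtain ⟨m₂, t₂, h4, h5, h6⟩ := h' _ h3
  exact ⟨m₂, _, .seq _ _ _ _ _ _ _ h1 h4, by omega, h6⟩

theorem ite {b : BExp} (h : b.holds m → Exec O T P m c Q) (h' : ¬ b.holds m → Exec O T P' m c Q) :
    Exec O T (Prog.ite b P P') m (b.cost + c + 1) Q := by
  by_cases hb : b.holds m
  · obtain ⟨m₁, t₁, h1, h2, h3⟩ := h hb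
    exact ⟨m₁, _, .iteTrue _ _ _ _ _ _ hb h1, by omega, h3⟩
  · obtain ⟨m₁, t₁, h1, h2, h3⟩ := h' hb
    exact ⟨m₁, _, .iteFalse _ _ _ _ _ _ hb h1, by omega, h3⟩

end Exec

/-- `for a[0] := 0, …, n - 1 do P`, where `n` is entry `0` of the integer array `0`. -/
def forLoop (a : ℕ) (P : Prog) : Prog :=
  .seq (.setNat a (.lit 0) (.lit 0))
    (.loop (.natLe (.plus (.get a (.lit 0)) (.lit 1)) (.get 0 (.lit 0)))
      (.seq P (.setNat a (.lit 0) (.plus (.get a (.lit 0)) (.lit 1)))))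

/-- Hoare rule with invariant `J`, required again only after the counter increment. Each round adds
`8` for the test and `6` for the increment; initialisation and the final test cost `3 + 8`. -/
theorem exec_forLoop {n : ℕ} {O : Set (Fin n) → Option ((Fin n → ℝ) × ℝ)} {T : ℕ} {a c : ℕ}
    {P : Prog} (J : ℕ → Memory → Prop) (hJ : ∀ k m, J k m → m.nat a 0 = k ∧ m.nat 0 0 = n)
    (hP : ∀ k m, k < n → J k m →
      Exec O T P m c fun m' => m'.nat a 0 = k ∧ J (k + 1) (m'.writeNat a 0 (k + 1)))
    {m : Memory} (hm : J 0 (m.writeNat a 0 0)) :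
    Exec O T (forLoop a P) m (n * (c + 14) + 11) (J n) := by
  have hloop : ∀ d k m, k + d = n → J k m → Exec O T
      (.loop (.natLe (.plus (.get a (.lit 0)) (.lit 1)) (.get 0 (.lit 0)))
        (.seq P (.setNat a (.lit 0) (.plus (.get a (.lit 0)) (.lit 1))))) m
        (d * (c + 14) + 8) (J n) := by
    intro d
    induction d with
    | zero =>
      intro k m hk hJk
      obtain ⟨h1, h2⟩ := hJ k m hJk
      refine ⟨m, _, .loopDone _ _ _ ?_, ?_, ?_⟩
      · simp [BExp.holds, NExp.eval, h1, h2]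
        omega
      · simp [BExp.cost, NExp.cost]
      · rwa [← hk]
    | succ d ih =>
      intro k m hk hJk
      obtain ⟨h1, h2⟩ := hJ k m hJk
      have hb : BExp.holds m (.natLe (.plus (.get a (.lit 0)) (.lit 1)) (.get 0 (.lit 0))) := by
        simp [BExp.holds, NExp.eval, h1, h2]
        omega
      have hbody := (hP k m (by omega) hJk).seq (P' := .setNat a (.lit 0)
        (.plus (.get a (.lit 0)) (.lit 1))) (Q' := J (k + 1)) fun m' hm' =>
          Exec.setNat (by simpa [NExp.eval, hm'.1] using hm'.2)
      obtain ⟨m₁, t₁, r1, r2, r3⟩ := hbody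
      obtain ⟨m₂, t₂, r4, r5, r6⟩ := ih (k + 1) m₁ (by omega) r3
      refine ⟨m₂, _, .loopStep _ _ _ _ _ _ _ hb r1 r4, ?_, r6⟩
      simp only [BExp.cost, NExp.cost] at r2 ⊢
      rw [Nat.succ_mul]
      omega
  refine (Exec.seq (Exec.setNat (Q := J 0) (by simpa [NExp.eval] using hm))
    fun m' hm' => hloop n 0 m' (by omega) hm').mono ?_ fun _ h => h
  simp only [NExp.cost]
  omega

/-! ### Symbolic expressions -/

namespace NExp

/-- The expression `j * e` for a fixed `j`. -/
def mulLit (e : NExp) : ℕ → NExp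
  | 0 => .lit 0
  | j + 1 => .plus (mulLit e j) e

theorem eval_mulLit (m : Memory) (e : NExp) (j : ℕ) : (e.mulLit j).eval m = j * e.eval m := by
  induction j with
  | zero => simp [mulLit, eval]
  | succ j ih => simp [mulLit, eval, ih, Nat.succ_mul]

end NExp

namespace RExp

/-- The sum of a list of expressions. -/
def sum (l : List RExp) : RExp := l.foldr .plus (.lit 0)

theorem eval_sum (m : Memory) (l : List RExp) : (sum l).eval m = (l.map (eval m)).sum := by
  induction l with
  | nil => simp [sum, eval]
  | cons e l ih =>
    rw [List.map_cons, List.sum_cons, ← ih]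
    rfl

/-- The power of an expression with a fixed exponent. -/
def power (e : RExp) : ℕ → RExp
  | 0 => .lit 1
  | j + 1 => .times (power e j) e

theorem eval_power (m : Memory) (e : RExp) (j : ℕ) : (e.power j).eval m = e.eval m ^ j := by
  induction j with
  | zero => simp [power, eval]
  | succ j ih => simp [power, eval, ih, pow_succ]

end RExp

namespace BExp

/-- Disjunction. -/
def disj (b b' : BExp) : BExp := .neg (.conj (.neg b) (.neg b'))

@[simp] theorem holds_disj (m : Memory) (b b' : BExp) :
    (disj b b').holds m ↔ b.holds m ∨ b'.holds m := by
  simp only [disj, holds]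
  tauto

/-- The test that fails always. -/
def never : BExp := .neg (.natLe (.lit 0) (.lit 0))

@[simp] theorem holds_never (m : Memory) : ¬ never.holds m := by
  simp [never, holds]

/-- Strict comparison of reals. -/
def realLt (e e' : RExp) : BExp := .neg (.realLe e' e)

@[simp] theorem holds_realLt (m : Memory) (e e' : RExp) :
    (realLt e e').holds m ↔ e.eval m < e'.eval m := by
  simp [realLt, holds]

/-- The disjunction of a list of tests. -/
def any (l : List BExp) : BExp := l.foldr disj never

theorem holds_any (m : Memory) (l : List BExp) : (any l).holds m ↔ ∃ b ∈ l, b.holds m := by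
  induction l with
  | nil => simp [any]
  | cons b l ih =>
    have : any (b :: l) = disj b (any l) := rfl
    simp [this, ih]

end BExp

/-- Symbolic polynomials: sequences of expressions for the coefficients. -/
abbrev PExp : Type := ℕ → RExp

namespace PExp

/-- In the memory `m`, the coefficients of `e` evaluate to those of `p`. -/
def Represents (m : Memory) (e : PExp) (p : ℝ[X]) : Prop := ∀ i, (e i).eval m = p.coeff i

/-- The constant polynomial `1`. -/
def one : PExp := fun i => .lit (if i = 0 then 1 else 0)

/-- The product of symbolic polynomials. -/
noncomputable def mul (e e' : PExp) : PExp := fun i =>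
  .sum ((Finset.HasAntidiagonal.antidiagonal i).toList.map fun q => .times (e q.1) (e' q.2))

/-- A rational multiple of a symbolic polynomial. -/
def scale (q : ℚ) (e : PExp) : PExp := fun i => .times (.lit q) (e i)

/-- The product of a list of symbolic polynomials. -/
noncomputable def prod (l : List PExp) : PExp := l.foldr mul one

/-- The sum of a list of symbolic polynomials. -/
def sum (l : List PExp) : PExp := fun i => .sum (l.map fun e => e i)

/-- The determinant of a matrix of symbolic polynomials. -/
noncomputable def det {d : ℕ} (M : Fin d → Fin d → PExp) : PExp :=
  sum ((Finset.univ : Finset (Equiv.Perm (Fin d))).toList.map fun σ =>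
    scale ((Equiv.Perm.sign σ : ℤ) : ℚ) (prod ((List.finRange d).map fun l => M (σ l) l)))

variable {m : Memory}

theorem represents_one : Represents m one 1 := by
  intro i
  simp only [one, RExp.eval, coeff_one]
  split_ifs <;> simp

theorem Represents.mul {e e' : PExp} {p p' : ℝ[X]} (h : Represents m e p)
    (h' : Represents m e' p') : Represents m (mul e e') (p * p') := by
  intro i
  rw [PExp.mul, RExp.eval_sum, coeff_mul, List.map_map, ← Finset.sum_map_toList]
  congr 1
  refine List.map_congr_left fun q _ => ?_
  simp [RExp.eval, h q.1, h' q.2]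

theorem Represents.scale {e : PExp} {p : ℝ[X]} (h : Represents m e p) (q : ℚ) :
    Represents m (scale q e) (C (q : ℝ) * p) := by
  intro i
  simp [PExp.scale, RExp.eval, h i]

theorem Represents.prod {ι : Type*} (l : List ι) {e : ι → PExp} {p : ι → ℝ[X]}
    (h : ∀ i, Represents m (e i) (p i)) : Represents m (prod (l.map e)) (l.map p).prod := by
  induction l with
  | nil => simpa [PExp.prod] using represents_one
  | cons i l ih =>
    rw [List.map_cons, List.map_cons, List.prod_cons]
    exact (h i).mul ih

theorem Represents.sum {ι : Type*} (l : List ι) {e : ι → PExp} {p : ι → ℝ[X]}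
    (h : ∀ i, Represents m (e i) (p i)) : Represents m (sum (l.map e)) (l.map p).sum := by
  intro i
  rw [PExp.sum, RExp.eval_sum]
  induction l with
  | nil => simp
  | cons j l ih =>
    simp only [List.map_cons, List.sum_cons, coeff_add] at ih ⊢
    rw [ih, h j i]

/-- The Leibniz expansion needs no pivoting or branching, so for fixed `d` it is one fixed
expression per coefficient. -/
theorem Represents.det {d : ℕ} {M : Fin d → Fin d → PExp} {N : Fin d → Fin d → ℝ[X]}
    (h : ∀ l j, Represents m (M l j) (N l j)) : Represents m (det M) (of N).det := by
  have h1 := Represents.sum (m := m) (Finset.univ : Finset (Equiv.Perm (Fin d))).toList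
    (fun σ => (Represents.prod (List.finRange d) (fun l => h (σ l) l)).scale
      ((Equiv.Perm.sign σ : ℤ) : ℚ))
  rw [Finset.sum_map_toList] at h1
  have h2 : (of N).det = ∑ σ : Equiv.Perm (Fin d), C (((Equiv.Perm.sign σ : ℤ) : ℚ) : ℝ) *
      ((List.finRange d).map fun l => N (σ l) l).prod := by
    rw [det_apply']
    refine Finset.sum_congr rfl fun σ _ => ?_
    rw [← List.ofFn_eq_map, List.prod_ofFn]
    simp
  rw [h2]
  exact h1

/-- The test whether a symbolic polynomial of degree less than `D` is positive at small positive
arguments. -/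
def infPosTest : ℕ → PExp → BExp
  | 0, _ => .never
  | D + 1, e => .disj (.realLt (.lit 0) (e 0))
      (.conj (.realLe (.lit 0) (e 0)) (infPosTest D fun i => e (i + 1)))

/-- The first nonzero coefficient decides; a vanishing constant coefficient permits division by `X`
without changing the sign. -/
theorem holds_infPosTest (D : ℕ) {e : PExp} {p : ℝ[X]} (h : Represents m e p)
    (hD : ∀ i, D ≤ i → p.coeff i = 0) : (infPosTest D e).holds m ↔ InfPos p := by
  induction D generalizing e p with
  | zero =>
    have : p = 0 := by
      ext i
      simpa using hD i (Nat.zero_le i)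
    subst this
    have h0 : ¬ InfPos 0 := fun h => h.not_neg (by simpa using h)
    simp [infPosTest, h0]
  | succ D ih =>
    have h' : Represents m (fun i => e (i + 1)) p.divX := fun i => by rw [coeff_divX]; exact h _
    have ih' := ih h' fun i hi => by
      rw [coeff_divX]
      exact hD _ (Nat.succ_le_succ hi)
    have hp := p.divX_mul_X_add
    simp only [infPosTest, BExp.holds_disj, BExp.holds_realLt, BExp.holds, ih', h 0, RExp.eval,
      Rat.cast_zero]
    rcases lt_trichotomy (p.coeff 0) 0 with h0 | h0 | h0
    · have : InfPos (-p) := infPos_of_coeff_zero_pos (by simpa using h0)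
      have h1 : ¬ InfPos p := fun h' => h'.not_neg this
      simp only [h1, iff_false, not_or, not_lt, not_and]
      exact ⟨h0.le, fun h2 => absurd h0 (not_lt.2 h2)⟩
    · rw [h0, C_0, add_zero, mul_comm] at hp
      rw [h0, ← infPos_X_mul, hp]
      simp
    · simp [h0, infPos_of_coeff_zero_pos h0]

end PExp

/-- The `r + 2` rows have entries of degree at most `2`, so `2 * (r + 2) + 1` coefficients suffice
for the sign test. -/
theorem coeff_tupleDet_eq_zero {r n : ℕ} (A : Matrix (Fin r) (Fin n) ℝ) (κ : ℚ) (u : Fin r → ℚ)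
    (τ : Fin (r + 1) → Fin n × Fin 3) (k : Fin n × Fin 3) {i : ℕ} (hi : 2 * (r + 2) < i) :
    (tupleDet A κ u τ k).coeff i = 0 := by
  refine coeff_eq_zero_of_natDegree_lt (lt_of_le_of_lt ?_ hi)
  rw [tupleDet, det_apply]
  refine natDegree_sum_le_of_forall_le _ _ fun σ _ => ?_
  refine (natDegree_smul_le _ _).trans ((natDegree_prod_le _ _).trans ?_)
  refine (Finset.sum_le_card_nsmul _ _ 2 fun l _ => ?_).trans (by simp; omega)
  simp only [of_apply, pertForm]
  compute_degree

/-! ### The program -/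

/-- The index stored in the integer array `4` or, for `l ≤ r`, in the integer array `5 + l`. -/
def indexExp (r : ℕ) : Fin (r + 2) → NExp :=
  Fin.snoc (α := fun _ => NExp) (fun l : Fin (r + 1) => .get (5 + l) (.lit 0)) (.get 4 (.lit 0))

/-- The weight of the form `(e, b)`; the real array `4` holds the indices as reals. -/
def weightExp (e : NExp) (b : Fin 3) : RExp :=
  .plus (.times (.lit 3) (.get 4 e)) (.lit (b : ℕ))

/-- The symbolic perturbed form `(e, b)`. -/
def formExp {r : ℕ} (κ : ℚ) (u : Fin r → ℚ) (e : NExp) (b : Fin 3) (j : Fin (r + 2)) : PExp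
  | 0 => Fin.snoc (α := fun _ => RExp) (Fin.snoc (α := fun _ => RExp)
      (fun j : Fin r => .times (.lit κ) (.get 0 (.plus e ((NExp.get 0 (.lit 0)).mulLit j))))
      (.lit (if b = 0 then -1 else 0))) (.lit (if b = 1 then -1 else 0)) j
  | 1 => Fin.snoc (α := fun _ => RExp) (Fin.snoc (α := fun _ => RExp)
      (fun j : Fin r => .times (.lit (-u j)) (weightExp e b)) (.lit 0)) (.lit 0) j
  | 2 => (weightExp e b).power j
  | _ => .lit 0

/-- The symbolic determinant of the forms of the tuple, with blocks `β`, and the form given by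
the integer array `4` and the block `b`. -/
noncomputable def tupleDetExp {r : ℕ} (κ : ℚ) (u : Fin r → ℚ) (β : Fin (r + 1) → Fin 3)
    (b : Fin 3) : PExp :=
  .det fun l j => formExp κ u (indexExp r l) (Fin.snoc (α := fun _ => Fin 3) β b l) j

/-- The test whether the index in the integer array `4` belongs to the enumerated support. -/
noncomputable def memberTest {r : ℕ} (κ : ℚ) (u : Fin r → ℚ) (s : ℚ) (g : Fin (r + 1) → Bool)
    (β : Fin (r + 1) → Fin 3) : BExp :=
  .disj (.any (((List.finRange (r + 1)).filter fun j => g j).map fun j : Fin (r + 1) =>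
      .conj (.natLe (.get (5 + (j : ℕ)) (.lit 0)) (.get 4 (.lit 0)))
        (.natLe (.get 4 (.lit 0)) (.get (5 + (j : ℕ)) (.lit 0)))))
    (.disj (PExp.infPosTest (2 * (r + 2) + 1) (.scale s (tupleDetExp κ u β 0)))
      (PExp.infPosTest (2 * (r + 2) + 1) (.scale (-s) (tupleDetExp κ u β 1))))

/-- The memory holds the input and the table of the indices as reals. -/
def Ready {r n : ℕ} (A : Matrix (Fin r) (Fin n) ℝ) (m : Memory) : Prop :=
  m.nat 0 0 = n ∧ (∀ (j : Fin r) (i : Fin n), m.real 0 ((i : ℕ) + n * (j : ℕ)) = A j i) ∧ ∀ i < n, m.real 4 i = i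

theorem represents_formExp {r n : ℕ} {A : Matrix (Fin r) (Fin n) ℝ} {m : Memory} (h : Ready A m)
    (κ : ℚ) (u : Fin r → ℚ) {e : NExp} {k : Fin n × Fin 3} (he : e.eval m = k.1)
    (j : Fin (r + 2)) : PExp.Represents m (formExp κ u e k.2 j) (pertForm A κ u k j) := by
  obtain ⟨h1, h2, h3⟩ := h
  have hw : (weightExp e k.2).eval m = weight k := by
    simp [weightExp, RExp.eval, he, h3 _ k.1.2, weight]
  intro i
  simp only [pertForm, coeff_add, coeff_C_mul, coeff_C, coeff_X, coeff_X_pow]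
  match i with
  | 0 =>
    simp only [formExp, baseCoeff]
    refine Fin.lastCases ?_ (fun j => Fin.lastCases ?_ (fun j => ?_) j) j
    · by_cases hk : k.2 = 1 <;> simp [RExp.eval, hk]
    · by_cases hk : k.2 = 0 <;> simp [RExp.eval, hk]
    · simp [RExp.eval, NExp.eval, NExp.eval_mulLit, he, h1, ← h2, mul_comm]
  | 1 =>
    simp only [formExp, slopeCoeff]
    refine Fin.lastCases ?_ (fun j => Fin.lastCases ?_ (fun j => ?_) j) j
    · simp [RExp.eval]
    · simp [RExp.eval]
    · simp [RExp.eval, hw]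
  | 2 => simp [formExp, RExp.eval_power, hw]
  | i + 3 => simp [formExp, RExp.eval]

theorem represents_tupleDetExp {r n : ℕ} {A : Matrix (Fin r) (Fin n) ℝ} {m : Memory}
    (h : Ready A m) (κ : ℚ) (u : Fin r → ℚ) (β : Fin (r + 1) → Fin 3) (b : Fin 3)
    {τ : Fin (r + 1) → Fin n} {i : Fin n} (hτ : ∀ l : Fin (r + 1), m.nat (5 + l) 0 = τ l)
    (hi : m.nat 4 0 = i) :
    PExp.Represents m (tupleDetExp κ u β b) (tupleDet A κ u (fun l => (τ l, β l)) (i, b)) := by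
  refine PExp.Represents.det fun l j => ?_
  have hb : Fin.snoc (α := fun _ => Fin 3) β b l =
      (Fin.snoc (α := fun _ => Fin n × Fin 3) (fun l => (τ l, β l)) (i, b) l).2 := by
    refine Fin.lastCases ?_ (fun l => ?_) l <;> simp
  rw [hb]
  refine represents_formExp h κ u ?_ j
  refine Fin.lastCases ?_ (fun l => ?_) l
  · simp [indexExp, NExp.eval, hi]
  · simp [indexExp, NExp.eval, hτ]

theorem holds_memberTest {r n : ℕ} {A : Matrix (Fin r) (Fin n) ℝ} {m : Memory}
    (h : Ready A m) (κ : ℚ) (u : Fin r → ℚ) (s : ℚ) (g : Fin (r + 1) → Bool)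
    (β : Fin (r + 1) → Fin 3) {τ : Fin (r + 1) → Fin n} {i : Fin n}
    (hτ : ∀ l : Fin (r + 1), m.nat (5 + l) 0 = τ l) (hi : m.nat 4 0 = i) :
    (memberTest κ u s g β).holds m ↔ i ∈ enumSupport A κ u s g fun l => (τ l, β l) := by
  have hdet : ∀ (q : ℚ) b, (PExp.infPosTest (2 * (r + 2) + 1)
      (.scale q (tupleDetExp κ u β b))).holds m ↔
      InfPos (C (q : ℝ) * tupleDet A κ u (fun l => (τ l, β l)) (i, b)) := fun q b =>
    PExp.holds_infPosTest _ ((represents_tupleDetExp h κ u β b hτ hi).scale q) fun l hl => by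
      rw [coeff_C_mul, coeff_tupleDet_eq_zero A κ u _ _ hl, mul_zero]
  simp only [memberTest, BExp.holds_disj, hdet, BExp.holds_any, enumSupport, Set.mem_ofPred_eq,
    Rat.cast_neg]
  refine or_congr_left ?_
  simp only [List.mem_map, List.mem_filter, List.mem_finRange, true_and, exists_exists_and_eq_and,
    BExp.holds, NExp.eval, hτ, hi]
  refine exists_congr fun j => ?_
  rw [and_comm, ← le_antisymm_iff, Fin.ext_iff]

/-- Write the indicator vector of the enumerated support of `γ` to the integer array `1`. -/
noncomputable def markProg {r : ℕ} (γ : Config r) : Prog :=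
  forLoop 4 (.ite (memberTest (if γ.1 then 1 else 0) (Pi.single γ.2.1.1 (signOf γ.2.1.2))
      (signOf γ.2.2.1) γ.2.2.2.1 γ.2.2.2.2)
    (.setNat 1 (.get 4 (.lit 0)) (.lit 1)) (.setNat 1 (.get 4 (.lit 0)) (.lit 0)))

/-- Copy the vector returned by the oracle to the output. -/
def copyProg : Prog :=
  forLoop 4 (.setReal 3 (.get 4 (.lit 0)) (.get 1 (.get 4 (.lit 0))))

/-- Keep the answer of the oracle if it improves on the best value so far, which is entry `0` of
the real array `5` once entry `0` of the integer array `3` has been set. -/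
def keepProg : Prog :=
  .ite (.conj (.natLe (.lit 1) (.get 2 (.lit 0))) (.disj (.natLe (.get 3 (.lit 0)) (.lit 0))
      (.realLt (.get 5 (.lit 0)) (.get 2 (.lit 0)))))
    (.seq copyProg (.seq (.setReal 5 (.lit 0) (.get 2 (.lit 0))) (.setNat 3 (.lit 0) (.lit 1))))
    .skip

/-- Test the enumerated support of `γ`. -/
noncomputable def tryProg {r : ℕ} (γ : Config r) : Prog :=
  .seq (markProg γ) (.seq .query keepProg)

/-- Execute all the programs of a list. -/
def seqAll (l : List Prog) : Prog := l.foldr .seq .skip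

/-- Nested loops over the integer arrays `5, …, 5 + L - 1`. -/
def nestedLoops (P : Prog) : ℕ → Prog
  | 0 => P
  | L + 1 => forLoop (5 + L) (nestedLoops P L)

/-- Write the table of the indices as reals to the real array `4`. -/
def tableProg : Prog :=
  forLoop 4 (.setReal 4 (.plus (.get 4 (.lit 0)) (.lit 1))
    (.plus (.get 4 (.get 4 (.lit 0))) (.lit 1)))

/-- The program enumerating the supports. -/
noncomputable def solveProg (r : ℕ) : Prog :=
  .seq tableProg
    (nestedLoops (seqAll ((Finset.univ : Finset (Config r)).toList.map tryProg)) (r + 1))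

/-! ### Correctness and running time of the program. -/

section Correctness

variable {r n : ℕ} {A : Matrix (Fin r) (Fin n) ℝ} {O : Set (Fin n) → Option ((Fin n → ℝ) × ℝ)}
  {T : ℕ}

/-- The membership test is a fixed expression for given `γ`, so its cost is constant and `c`
precedes `n`. -/
theorem exec_markProg (γ : Config r) : ∃ c : ℕ, ∀ {n : ℕ} {A : Matrix (Fin r) (Fin n) ℝ}
    {O : Set (Fin n) → Option ((Fin n → ℝ) × ℝ)} {T : ℕ} {m : Memory} {τ : Fin (r + 1) → Fin n},
    Ready A m → (∀ l : Fin (r + 1), m.nat (5 + l) 0 = τ l) →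
    Exec O T (markProg γ) m (n * c + 11) fun m' => m'.real = m.real ∧
      (∀ a i, a ≠ 1 → a ≠ 4 → m'.nat a i = m.nat a i) ∧ m'.queried n = configSupport A γ τ := by
  set b := memberTest (if γ.1 then 1 else 0) (Pi.single γ.2.1.1 (signOf γ.2.1.2))
      (signOf γ.2.2.1) γ.2.2.2.1 γ.2.2.2.2
  refine ⟨b.cost + 4 + 1 + 14, fun {n A O T m τ} hm hτ => ?_⟩
  refine (exec_forLoop (n := n) (fun k m' => m'.nat 4 0 = k ∧ m'.real = m.real ∧
    (∀ a i, a ≠ 1 → a ≠ 4 → m'.nat a i = m.nat a i) ∧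
    ∀ i : Fin n, (i : ℕ) < k → (m'.nat 1 i ≠ 0 ↔ i ∈ configSupport A γ τ)) ?_ ?_ ?_).mono le_rfl ?_
  · rintro k m' ⟨h1, -, h3, -⟩
    exact ⟨h1, by rw [h3 0 0 (by omega) (by omega), hm.1]⟩
  · rintro k m' hk ⟨h1, h2, h3, h4⟩
    have hready : Ready A m' := ⟨by rw [h3 0 0 (by omega) (by omega), hm.1], by rw [h2]; exact hm.2⟩
    have hmem : b.holds m' ↔ (⟨k, hk⟩ : Fin n) ∈ configSupport A γ τ :=
      holds_memberTest hready _ _ _ _ _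
        (fun l => by rw [h3 _ _ (by omega) (by omega), hτ]) (i := ⟨k, hk⟩) h1
    have step : ∀ v : ℕ, (v ≠ 0 ↔ (⟨k, hk⟩ : Fin n) ∈ configSupport A γ τ) →
        Exec O T (.setNat 1 (.get 4 (.lit 0)) (.lit v)) m' 4 fun m'' => m''.nat 4 0 = k ∧
          (m''.writeNat 4 0 (k + 1)).nat 4 0 = k + 1 ∧
          (m''.writeNat 4 0 (k + 1)).real = m.real ∧
          (∀ a i, a ≠ 1 → a ≠ 4 → (m''.writeNat 4 0 (k + 1)).nat a i = m.nat a i) ∧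
          ∀ i : Fin n, (i : ℕ) < k + 1 →
            ((m''.writeNat 4 0 (k + 1)).nat 1 i ≠ 0 ↔ i ∈ configSupport A γ τ) := by
      intro v hv
      refine (Exec.setNat ?_).mono (by simp [NExp.cost]) fun _ h => h
      simp only [NExp.eval, h1, Memory.nat_writeNat, Memory.real_writeNat]
      refine ⟨by simp, by simp, h2, fun a i ha ha' => by simp [ha, ha', h3 a i ha ha'], ?_⟩
      intro i hi
      simp only [show ¬ ((1 : ℕ) = 4) by omega, false_and, if_false, true_and]
      split_ifs with hik
      · rw [hv]
        have : i = ⟨k, hk⟩ := Fin.ext hik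
        rw [this]
      · exact h4 i (by omega)
    refine Exec.ite (fun hh => ?_) (fun hh => ?_)
    · exact step 1 (by simpa using hmem.1 hh)
    · exact step 0 (by simpa using fun h => hh (hmem.2 h))
  · refine ⟨by simp, rfl, fun a i _ ha => by simp [ha], fun i hi => absurd hi (by omega)⟩
  · rintro m' ⟨-, h2, h3, h4⟩
    refine ⟨h2, h3, ?_⟩
    ext i
    exact h4 i i.2

theorem exec_copyProg {m : Memory} (hm : m.nat 0 0 = n) :
    Exec O T copyProg m (n * 20 + 11) fun m' => (∀ a i, a ≠ 4 → m'.nat a i = m.nat a i) ∧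
      (∀ a i, a ≠ 3 → m'.real a i = m.real a i) ∧ ∀ i < n, m'.real 3 i = m.real 1 i := by
  refine (exec_forLoop (n := n) (c := 6) (fun k m' => m'.nat 4 0 = k ∧
    (∀ a i, a ≠ 4 → m'.nat a i = m.nat a i) ∧
    (∀ a i, a ≠ 3 → m'.real a i = m.real a i) ∧ ∀ i < k, m'.real 3 i = m.real 1 i)
    ?_ ?_ ?_).mono le_rfl ?_
  · rintro k m' ⟨h1, h2, -, -⟩
    exact ⟨h1, by rw [h2 0 0 (by omega), hm]⟩
  · rintro k m' hk ⟨h1, h2, h3, h4⟩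
    refine (Exec.setReal ?_).mono (by simp [NExp.cost, RExp.cost]) fun _ h => h
    simp only [NExp.eval, RExp.eval, h1, Memory.nat_writeNat, Memory.real_writeNat,
      Memory.nat_writeReal, Memory.real_writeReal]
    refine ⟨trivial, by simp, fun a i ha => by simp [ha, h2 a i ha],
      fun a i ha => by simp [ha, h3 a i ha], fun i hi => ?_⟩
    simp only [true_and]
    split_ifs with hik
    · rw [hik, h3 1 k (by omega)]
    · exact h4 i (by omega)
  · exact ⟨by simp, fun a i ha => by simp [ha], fun _ _ _ => rfl, fun i hi => absurd hi (by omega)⟩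
  · rintro m' ⟨-, h2, h3, h4⟩
    exact ⟨h2, h3, h4⟩

/-- The memory is ready, and the output, if there is one, is feasible with the recorded value. -/
def Sound (A : Matrix (Fin r) (Fin n) ℝ) (X : Set (Fin n → ℝ)) (g : (Fin n → ℝ) → ℝ)
    (m : Memory) : Prop :=
  Ready A m ∧ (m.nat 3 0 ≠ 0 → m.output n ∈ X ∧ g (m.output n) = m.real 5 0)

/-- The recorded value is at least `z`. -/
def Reached (z : ℝ) (m : Memory) : Prop := m.nat 3 0 ≠ 0 ∧ z ≤ m.real 5 0

/-- The value `z` is a target, later the optimum. Records are replaced only by larger values, so a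
reached target stays reached. -/
theorem exec_keepProg {X : Set (Fin n → ℝ)} {g : (Fin n → ℝ) → ℝ}
    (hO : SolvesFixedSupport X g O) {m : Memory} (hm : Sound A X g m) (S : Set (Fin n)) (z : ℝ) :
    Exec O T keepProg (m.receive (O S)) (n * 20 + 40) fun m' => Sound A X g m' ∧
      (∀ l, m'.nat (5 + l) 0 = m.nat (5 + l) 0) ∧ (Reached z m → Reached z m') ∧
      ((∃ x, O S = some (x, z)) → Reached z m') := by
  obtain ⟨⟨h0, hA, hI⟩, hout⟩ := hm
  cases hOS : O S with
  | none =>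
    refine (Exec.ite (c := 1) (fun hb => ?_) (fun _ => Exec.skip ?_)).mono ?_ fun _ h => h
    · simp [BExp.holds, NExp.eval, Memory.receive] at hb
    · refine ⟨⟨⟨by simpa [Memory.receive] using h0, hA, hI⟩, ?_⟩, fun l => ?_, ?_, ?_⟩
      · exact fun h => hout (by simpa [Memory.receive] using h)
      · have h5 : 5 + l ≠ 2 := by omega
        simp [Memory.receive, h5]
      · simp [Reached, Memory.receive]
      · simp
    · simp [BExp.cost, BExp.disj, BExp.realLt, NExp.cost, RExp.cost]
  | some q =>
    obtain ⟨x, t⟩ := q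
    obtain ⟨⟨⟨hxX, -⟩, -⟩, ht⟩ := (hO S).1 x t hOS
    have hnat : ∀ a i, a ≠ 2 → (m.receive (some (x, t))).nat a i = m.nat a i := fun a i ha => by
      simp [Memory.receive, ha]
    have hreal : ∀ a i, a ≠ 1 → a ≠ 2 → (m.receive (some (x, t))).real a i = m.real a i :=
      fun a i ha ha' => by simp [Memory.receive, ha, ha']
    have hx : ∀ i : Fin n, (m.receive (some (x, t))).real 1 i = x i := fun i => by
      simp [Memory.receive]
    have ht2 : (m.receive (some (x, t))).real 2 0 = t := by simp [Memory.receive]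
    have hn2 : (m.receive (some (x, t))).nat 2 0 = 1 := by simp [Memory.receive]
    set m₂ := m.receive (some (x, t))
    have h02 : m₂.nat 0 0 = n := by rw [hnat _ _ (by omega), h0]
    refine (Exec.ite (c := n * 20 + 11 + (5 + 3)) (fun hb => ?_)
      (fun hb => (Exec.skip ?_).mono (by omega) fun _ h => h)).mono ?_ fun _ h => h
    · have hbet : m.nat 3 0 = 0 ∨ m.real 5 0 < t := by
        simpa [BExp.holds, NExp.eval, RExp.eval, ht2, hn2, hnat 3, hreal 5] using hb
      refine (exec_copyProg h02).seq fun m₃ ⟨h31, h32, h33⟩ => ?_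
      refine (Exec.seq (Exec.setReal (Q := fun m₄ => m₄ = m₃.writeReal 5 0 t) ?_)
        fun m₄ h4 => Exec.setNat ?_).mono (by simp [NExp.cost, RExp.cost]) fun _ h => h
      · simp [NExp.eval, RExp.eval, h32 2, ht2]
      · have hval : (m₄.writeNat 3 0 1).real 5 0 = t := by simp [h4]
        have hfl : (m₄.writeNat 3 0 1).nat 3 0 = 1 := by simp
        have hxo : (m₄.writeNat 3 0 1).output n = x := by
          ext i
          simp [Memory.output, h4, h33 i i.2, hx]
        simp only [NExp.eval]
        refine ⟨⟨⟨?_, ?_, ?_⟩, fun _ => ?_⟩, fun l => ?_, fun hr => ⟨?_, ?_⟩, ?_⟩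
        · simp [h4, h31 0, h02]
        · intro j i
          simp [h4, h32 0, hreal 0, hA]
        · intro i hi
          simp [h4, h32 4, hreal 4, hI i hi]
        · rw [hxo, hval]
          exact ⟨hxX, ht.symm⟩
        · have h5 : 5 + l ≠ 3 := by omega
          simp [h4, h5, h31 (5 + l) 0 (by omega), hnat (5 + l) 0 (by omega)]
        · rw [hfl]; exact one_ne_zero
        · rw [hval]
          rcases hbet with h | h
          · exact absurd h hr.1
          · exact hr.2.trans h.le
        · rintro ⟨x', hx'⟩
          obtain ⟨rfl, rfl⟩ : x = x' ∧ t = z := by simpa using hx'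
          exact ⟨by rw [hfl]; exact one_ne_zero, hval.ge⟩
    · have hbet : m.nat 3 0 ≠ 0 ∧ t ≤ m.real 5 0 := by
        simpa [BExp.holds, NExp.eval, RExp.eval, ht2, hn2, hnat 3, hreal 5] using hb
      have ho : m₂.output n = m.output n := by
        ext i
        exact hreal _ _ (by omega) (by omega)
      refine ⟨⟨⟨h02, fun j i => ?_, fun i hi => ?_⟩, fun _ => ?_⟩, fun l => hnat _ _ (by omega),
        ?_, ?_⟩
      · rw [hreal _ _ (by omega) (by omega), hA]
      · rw [hreal _ _ (by omega) (by omega), hI i hi]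
      · rw [ho, hreal _ _ (by omega) (by omega)]
        exact hout hbet.1
      · simp [Reached, hnat 3, hreal 5]
      · rintro ⟨x', hx'⟩
        obtain ⟨rfl, rfl⟩ : x = x' ∧ t = z := by simpa using hx'
        simp [Reached, hnat 3, hreal 5, hbet.1, hbet.2]
    · simp [BExp.cost, BExp.disj, BExp.realLt, NExp.cost, RExp.cost]
      omega

theorem exec_tryProg (γ : Config r) : ∃ c : ℕ, ∀ {n : ℕ} {A : Matrix (Fin r) (Fin n) ℝ}
    {O : Set (Fin n) → Option ((Fin n → ℝ) × ℝ)} {T : ℕ} {X : Set (Fin n → ℝ)}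
    {g : (Fin n → ℝ) → ℝ} {m : Memory} {τ : Fin (r + 1) → Fin n} (z : ℝ),
    SolvesFixedSupport X g O → 0 < n → n ≤ T → Sound A X g m →
    (∀ l : Fin (r + 1), m.nat (5 + l) 0 = τ l) →
    Exec O T (tryProg γ) m (c * T) fun m' => Sound A X g m' ∧
      (∀ l, m'.nat (5 + l) 0 = m.nat (5 + l) 0) ∧ (Reached z m → Reached z m') ∧
      ((∃ x, O (configSupport A γ τ) = some (x, z)) → Reached z m') := by
  obtain ⟨c, hc⟩ := exec_markProg γ
  -- Besides `n * c`, the cost is `T + 20 * n + 51`, at most `72 * T` because `1 ≤ n ≤ T`.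
  refine ⟨c + 72, fun {n A O T X g m τ} z hO hn hT hm hτ => ?_⟩
  refine ((hc hm.1 hτ).seq fun m₁ ⟨h1, h2, h3⟩ => ?_).mono (c := n * c + 11 + (T + (n * 20 + 40)))
    ?_ fun _ h => h
  · refine (Exec.query (Q := fun m₂ => m₂ = m₁.receive (O (configSupport A γ τ)))
      (by rw [h3])).seq fun m₂ hm₂ => ?_
    have hm1 : Sound A X g m₁ := by
      obtain ⟨⟨k0, k1, k2⟩, k3⟩ := hm
      refine ⟨⟨by rw [h2 _ _ (by omega) (by omega), k0], by rwa [h1], by rwa [h1]⟩, ?_⟩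
      have : m₁.output n = m.output n := by
        ext i
        simp [Memory.output, h1]
      rwa [h2 _ _ (by omega) (by omega), this, h1]
    rw [hm₂]
    refine (exec_keepProg hO hm1 (configSupport A γ τ) z).mono le_rfl ?_
    rintro m' ⟨k1, k2, k3, k4⟩
    refine ⟨k1, fun l => by rw [k2, h2 _ _ (by omega) (by omega)], fun h => k3 ?_, k4⟩
    rwa [Reached, h2 _ _ (by omega) (by omega), h1]
  · have : n * c ≤ c * T := by rw [mul_comm]; exact Nat.mul_le_mul_left _ hT
    rw [add_mul]
    omega

theorem exec_seqAll (l : List (Config r)) : ∃ c : ℕ, ∀ {n : ℕ} {A : Matrix (Fin r) (Fin n) ℝ}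
    {O : Set (Fin n) → Option ((Fin n → ℝ) × ℝ)} {T : ℕ} {X : Set (Fin n → ℝ)}
    {g : (Fin n → ℝ) → ℝ} {m : Memory} {τ : Fin (r + 1) → Fin n} (z : ℝ),
    SolvesFixedSupport X g O → 0 < n → n ≤ T → Sound A X g m →
    (∀ l : Fin (r + 1), m.nat (5 + l) 0 = τ l) →
    Exec O T (seqAll (l.map tryProg)) m (c * T) fun m' => Sound A X g m' ∧
      (∀ l, m'.nat (5 + l) 0 = m.nat (5 + l) 0) ∧ (Reached z m → Reached z m') ∧
      ((∃ γ ∈ l, ∃ x, O (configSupport A γ τ) = some (x, z)) → Reached z m') := by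
  induction l with
  | nil =>
    refine ⟨1, fun {n A O T X g m τ} z hO hn hT hm hτ => (Exec.skip ?_).mono (by omega)
      fun _ h => h⟩
    exact ⟨hm, fun _ => rfl, id, by simp⟩
  | cons γ l ih =>
    obtain ⟨c, hc⟩ := ih
    obtain ⟨c', hc'⟩ := exec_tryProg γ
    refine ⟨c' + c, fun {n A O T X g m τ} z hO hn hT hm hτ => ?_⟩
    rw [add_mul]
    refine (hc' z hO hn hT hm hτ).seq fun m₁ ⟨h1, h2, h3, h4⟩ => ?_
    refine (hc z hO hn hT h1 (fun l => by rw [h2, hτ])).mono le_rfl ?_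
    rintro m' ⟨k1, k2, k3, k4⟩
    refine ⟨k1, fun l => by rw [k2, h2], fun h => k3 (h3 h), ?_⟩
    rintro ⟨γ', hγ', hx⟩
    rcases List.mem_cons.1 hγ' with rfl | h
    · exact k3 (h4 hx)
    · exact k4 ⟨γ', h, hx⟩

/-- `K` is an invariant and `D` a persistent goal, achieved when the counters equal `v`. The
induction runs from the innermost loop, with the counters from `L` on fixed: `D` is achieved in
round `v L` and survives the later ones. Loop overhead is `14 * n + 11 ≤ 25 * n` per level. -/
theorem exec_nestedLoops {P : Prog} {K D : Memory → Prop} {R c : ℕ} (hn : 0 < n) (hT : n ≤ T)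
    (hKn : ∀ m, K m → m.nat 0 0 = n) (hK : ∀ m l k, K m → K (m.writeNat (5 + l) 0 k))
    (hD : ∀ m l k, D m → D (m.writeNat (5 + l) 0 k)) (v : ℕ → ℕ) (hv : ∀ l < R, v l < n)
    (hP : ∀ m, K m → (∀ l < R, m.nat (5 + l) 0 < n) → Exec O T P m (c * T) fun m' => K m' ∧
      (∀ l, m'.nat (5 + l) 0 = m.nat (5 + l) 0) ∧ (D m → D m') ∧
      ((∀ l < R, m.nat (5 + l) 0 = v l) → D m')) (L : ℕ) (hL : L ≤ R) :
    ∀ m, K m → (∀ l, L ≤ l → l < R → m.nat (5 + l) 0 < n) →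
      Exec O T (nestedLoops P L) m ((c + 25 * L) * n ^ L * T) fun m' => K m' ∧
        (∀ l, L ≤ l → m'.nat (5 + l) 0 = m.nat (5 + l) 0) ∧ (D m → D m') ∧
        ((∀ l, L ≤ l → l < R → m.nat (5 + l) 0 = v l) → D m') := by
  induction L with
  | zero =>
    intro m hm hl
    refine (hP m hm fun l h => hl l (Nat.zero_le _) h).mono (by simp) ?_
    rintro m' ⟨h1, h2, h3, h4⟩
    exact ⟨h1, fun l _ => h2 l, h3, fun h => h4 fun l hl => h l (Nat.zero_le _) hl⟩
  | succ L ih =>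
    intro m hm hl
    refine (exec_forLoop (n := n) (c := (c + 25 * L) * n ^ L * T) (fun k m' => m'.nat (5 + L) 0 = k ∧
      K m' ∧ (∀ l, L + 1 ≤ l → m'.nat (5 + l) 0 = m.nat (5 + l) 0) ∧ (D m → D m') ∧
      ((∀ l, L + 1 ≤ l → l < R → m.nat (5 + l) 0 = v l) → v L < k → D m')) ?_ ?_ ?_).mono ?_ ?_
    · rintro k m' ⟨h1, h2, -⟩
      exact ⟨h1, hKn _ h2⟩
    · rintro k m' hk ⟨h1, h2, h3, h4, h5⟩
      refine (ih (by omega) m' h2 fun l hl1 hl2 => ?_).mono le_rfl ?_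
      · rcases hl1.eq_or_lt with rfl | h
        · rwa [h1]
        · rw [h3 l h]
          exact hl l h hl2
      · rintro m'' ⟨k1, k2, k3, k4⟩
        refine ⟨by rw [k2 L le_rfl, h1], by simp, hK _ _ _ k1, fun l hl' => ?_,
          fun h => hD _ _ _ (k3 (h4 h)), fun h hvk => hD _ _ _ ?_⟩
        · have : 5 + l ≠ 5 + L := by omega
          simp only [Memory.nat_writeNat, this, false_and, if_false]
          rw [k2 l (by omega), h3 l hl']
        · rcases (Nat.lt_succ_iff.1 hvk).eq_or_lt with hvk | hvk
          · refine k4 fun l hl1 hl2 => ?_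
            rcases hl1.eq_or_lt with rfl | hl1
            · rw [h1, hvk]
            · rw [h3 l hl1, h l hl1 hl2]
          · exact k3 (h5 h hvk)
    · refine ⟨by simp, hK _ _ _ hm, fun l hl' => ?_, hD _ _ _, fun _ h => absurd h (by omega)⟩
      have : 5 + l ≠ 5 + L := by omega
      simp only [Memory.nat_writeNat, this, false_and, if_false]
    · have h1 : n * ((c + 25 * L) * n ^ L * T) = (c + 25 * L) * n ^ (L + 1) * T := by ring
      have h2 : n ≤ n ^ (L + 1) * T :=
        (Nat.le_self_pow (by omega) n).trans (Nat.le_mul_of_pos_right _ (by omega))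
      have h3 : (c + 25 * (L + 1)) * n ^ (L + 1) * T =
          (c + 25 * L) * n ^ (L + 1) * T + 25 * (n ^ (L + 1) * T) := by ring
      rw [mul_add, h1, h3]
      omega
    · rintro m' ⟨-, h2, h3, h4, h5⟩
      exact ⟨h2, h3, h4, fun h => h5 h (hv L (by omega))⟩

theorem exec_tableProg (A : Matrix (Fin r) (Fin n) ℝ) (X : Set (Fin n → ℝ))
    (g : (Fin n → ℝ) → ℝ) :
    Exec O T tableProg (Memory.init A) (n * 24 + 11) (Sound A X g) := by
  have hA : ∀ (j : Fin r) (i : Fin n), (Memory.init A).real 0 ((i : ℕ) + n * (j : ℕ)) = A j i := by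
    intro j i
    have h1 : ((finProdFinEquiv (j, i) : Fin (r * n)) : ℕ) = (i : ℕ) + n * (j : ℕ) := by simp
    have h2 : (i : ℕ) + n * (j : ℕ) < r * n := h1 ▸ (finProdFinEquiv (j, i)).2
    have h3 : (⟨(i : ℕ) + n * (j : ℕ), h2⟩ : Fin (r * n)) = finProdFinEquiv (j, i) :=
      Fin.ext h1.symm
    simp only [Memory.init, h2, and_self, dif_pos, h3, Equiv.symm_apply_apply]
  -- The machine cannot cast integers to reals, so round `k` obtains entry `k + 1` from entry `k`.
  -- Entry `0` is initially zero, hence the bound `i ≤ k`.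
  refine (exec_forLoop (n := n) (c := 10) (fun k m => m.nat 4 0 = k ∧ m.nat 0 0 = n ∧
    m.nat 3 0 = 0 ∧ (∀ (j : Fin r) (i : Fin n), m.real 0 ((i : ℕ) + n * (j : ℕ)) = A j i) ∧
    ∀ i ≤ k, m.real 4 i = i) ?_ ?_ ?_).mono le_rfl ?_
  · rintro k m ⟨h1, h2, -⟩
    exact ⟨h1, h2⟩
  · rintro k m hk ⟨h1, h2, h3, h4, h5⟩
    refine (Exec.setReal ?_).mono (by simp [NExp.cost, RExp.cost]) fun _ h => h
    simp only [NExp.eval, RExp.eval, h1, h5 k le_rfl, Memory.nat_writeNat, Memory.real_writeNat,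
      Memory.nat_writeReal, Memory.real_writeReal]
    refine ⟨trivial, by simp, by simp [h2], by simp [h3], fun j i => by simp [h4], fun i hi => ?_⟩
    simp only [true_and]
    split_ifs with hik
    · rw [hik]; simp
    · exact h5 i (by omega)
  · refine ⟨by simp, by simp [Memory.init], by simp [Memory.init], hA, fun i hi => ?_⟩
    obtain rfl : i = 0 := by omega
    simp [Memory.init]
  · rintro m ⟨-, h2, h3, h4, h5⟩
    exact ⟨⟨h2, h4, fun i hi => h5 i hi.le⟩, fun h => absurd h3 h⟩

theorem exec_solveProg {r : ℕ} (hr : 1 ≤ r) : ∃ C : ℕ, ∀ (n : ℕ) (A : Matrix (Fin r) (Fin n) ℝ),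
    r ≤ n → ∀ (X : Set (Fin n → ℝ)) (g : (Fin n → ℝ) → ℝ)
    (O : Set (Fin n) → Option ((Fin n → ℝ) × ℝ)), SolvesFixedSupport X g O →
    (∃ S ∈ candidateSupports A, ∃ x, IsMaximizer X g x ∧ Function.support x = S) →
    ∀ T : ℕ, n ≤ T → Exec O T (solveProg r) (Memory.init A) (C * n ^ (r + 1) * T) fun m =>
      IsMaximizer X g (m.output n) := by
  obtain ⟨c, hc⟩ := exec_seqAll (r := r) (Finset.univ : Finset (Config r)).toList
  refine ⟨c + 25 * (r + 1) + 35, fun n A hrn X g O hO hex T hT => ?_⟩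
  obtain ⟨S, hS, x, hx, hxS⟩ := hex
  obtain ⟨γ, τ, hγ⟩ := exists_configSupport hr hrn A hS
  have hn : 0 < n := by omega
  -- On the support of an optimal solution the restricted problem attains the global optimum, so the
  -- oracle must answer with exactly this value. Reaching it makes the feasible output optimal.
  obtain ⟨y, hy⟩ : ∃ y, O S = some (y, g x) := by
    have hxm : IsMaximizer {y | y ∈ X ∧ Function.support y = S} g x :=
      ⟨⟨hx.1, hxS⟩, fun y hy => hx.2 y hy.1⟩
    cases hOS : O S with
    | none => exact absurd ⟨x, hxm⟩ ((hO S).2 hOS)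
    | some q =>
      obtain ⟨y, t⟩ := q
      obtain ⟨h1, h2⟩ := (hO S).1 y t hOS
      have h3 := h1.2 x hxm.1
      have h4 := hx.2 y h1.1.1
      exact ⟨y, by rw [h2, le_antisymm h4 h3]⟩
  refine ((exec_tableProg A X g).seq fun m hm => ?_).mono
    (c := n * 24 + 11 + (c + 25 * (r + 1)) * n ^ (r + 1) * T) ?_ fun _ h => h
  · refine (exec_nestedLoops (K := Sound A X g) (D := Reached (g x)) (R := r + 1) (c := c) hn hT
      (fun m hm => hm.1.1) ?_ ?_ (fun l => if h : l < r + 1 then τ ⟨l, h⟩ else 0) ?_ ?_ (r + 1) le_rfl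
      m hm ?_).mono le_rfl ?_
    · rintro m l k ⟨⟨h0, h1, h2⟩, h3⟩
      have h5 : 0 ≠ 5 + l := by omega
      have h6 : 3 ≠ 5 + l := by omega
      exact ⟨⟨by simpa [h5] using h0, h1, h2⟩, fun h => h3 (by simpa [h6] using h)⟩
    · rintro m l k h
      have h6 : 3 ≠ 5 + l := by omega
      simpa [Reached, h6] using h
    · intro l hl
      simp only [hl, dif_pos]
      exact (τ ⟨l, hl⟩).2
    · intro m hm hl
      refine (hc (τ := fun l => ⟨m.nat (5 + l) 0, hl l l.2⟩) (g x) hO hn hT hm fun l => rfl).mono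
        le_rfl ?_
      rintro m' ⟨h1, h2, h3, h4⟩
      refine ⟨h1, h2, h3, fun h => h4 ⟨γ, by simp, y, ?_⟩⟩
      have : (fun l : Fin (r + 1) => (⟨m.nat (5 + l) 0, hl l l.2⟩ : Fin n)) = τ := by
        ext l
        have hl' := h l l.2
        rw [dif_pos l.2] at hl'
        exact hl'
      rw [this, ← hγ, hy]
    · intro l h1 h2
      omega
    · rintro m' ⟨h1, -, -, h4⟩
      obtain ⟨k1, k2⟩ := h4 fun l h1 h2 => absurd h2 (by omega)
      obtain ⟨k3, k4⟩ := h1.2 k1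
      refine ⟨k3, fun y hy => ?_⟩
      rw [k4]
      exact (hx.2 y hy).trans k2
  · have h2 : n ≤ n ^ (r + 1) * T :=
      (Nat.le_self_pow (by omega) n).trans (Nat.le_mul_of_pos_right _ (by omega))
    have h3 : (c + 25 * (r + 1) + 35) * n ^ (r + 1) * T =
        (c + 25 * (r + 1)) * n ^ (r + 1) * T + 35 * (n ^ (r + 1) * T) := by ring
    rw [h3]
    omega

end Correctness

end Comonotone

theorem theorem5 (r : ℕ) (hr : 1 ≤ r) :
    (∃ C : ℕ, ∀ (n : ℕ) (A : Matrix (Fin r) (Fin n) ℝ), A.rank = r →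
      (Comonotone.candidateSupports A).ncard ≤ C * n ^ (r + 1) ∧
      ∀ (X : Set (Fin n → ℝ)) (f : (Fin r → ℝ) → ℝ),
        Comonotone.IsStandardComonotone X →
        ConvexOn ℝ Set.univ f →
        (∃ x, Comonotone.IsMaximizer X (fun y => f (A.mulVec y)) x) →
        ∃ S ∈ Comonotone.candidateSupports A,
          ∃ x, Comonotone.IsMaximizer X (fun y => f (A.mulVec y)) x ∧ Function.support x = S) ∧
    (∃ (P : Comonotone.Prog) (C : ℕ), ∀ (n : ℕ) (A : Matrix (Fin r) (Fin n) ℝ), A.rank = r →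
      ∀ (X : Set (Fin n → ℝ)) (f : (Fin r → ℝ) → ℝ),
        Comonotone.IsStandardComonotone X →
        ConvexOn ℝ Set.univ f →
        (∃ x, Comonotone.IsMaximizer X (fun y => f (A.mulVec y)) x) →
        ∀ O : Set (Fin n) → Option ((Fin n → ℝ) × ℝ),
          Comonotone.SolvesFixedSupport X (fun y => f (A.mulVec y)) O →
          ∀ T₁ : ℕ, n ≤ T₁ →
            ∃ (m : Comonotone.Memory) (t : ℕ),
              Comonotone.Runs O T₁ P (Comonotone.Memory.init A) m t ∧
              t ≤ C * n ^ (r + 1) * T₁ ∧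
              Comonotone.IsMaximizer X (fun y => f (A.mulVec y)) (m.output n)) := by
  -- Full row rank enters through `r ≤ n`, which with `1 ≤ r` provides the `r + 2` forms needed for
  -- the extreme-ray argument.
  have hrank : ∀ {n : ℕ} (A : Matrix (Fin r) (Fin n) ℝ), A.rank = r → r ≤ n := fun A hA => by
    simpa [hA] using A.rank_le_width
  refine ⟨⟨_, fun n A hA => ⟨Comonotone.ncard_candidateSupports_le hr (hrank A hA) A,
    fun X f hX hf hopt => Comonotone.exists_candidateSupport_isMaximizer A hX hf hopt⟩⟩, ?_⟩
  obtain ⟨C, hC⟩ := Comonotone.exec_solveProg hr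
  exact ⟨_, C, fun n A hA X f hX hf hopt O hO T hT => hC n A (hrank A hA) X _ O hO
    (Comonotone.exists_candidateSupport_isMaximizer A hX hf hopt) T hT⟩
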